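/- Let $E_8^3$ be the lattice of all $(m_1,m_2,m_3,m_4)$ with either all $m_i\in\mathbb Z$ or all $m_i\in\mathbb Z+\frac12$, and with $\sum m_i$ even, with norm $m_1^2+m_2^2+3m_3^2+3m_4^2$. Let $L=E_8^3(-1)\oplus II_{1,1}$, with elements $(r,m,n)$, $r\in E_8^3$, $m,n\in\mathbb Z$, of norm $(r,m,n)^2=-r^2-2mn$; it is a Lorentzian lattice of signature $(1,5)$. A root of $L$ is a primitive vector of $L$ of negative norm whose reflection is an automorphism of $L$. Let $Aut(L)^+$ be the group of automorphisms of $L$ that preserve each of the two cones of positive norm vectors of $L\otimes\mathbb R$, and let the reflection group $W$ be the group generated by the reflections in the roots of $L$; it is a subgroup of $Aut(L)^+$. Let $H$ be the hyperbolic space of norm $1$ vectors in the cone containing $(0,1,-1)$. The hyperplanes of the roots divide $H$ into Weyl chambers. The simple roots of a Weyl chamber $D$ are the roots $\alpha$ with $(\alpha,x)>0$ for $x$ in the interior of $D$ whose hyperplanes carry the faces of $D$. The group $W$ is called arithmetic if the group $Aut(D)$ of elements of $Aut(L)^+$ mapping $D$ to itself is finite (for every $D$). A Weyl vector of $D$ is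 a vector $v\in L\otimes\mathbb R$ with $(v,\alpha)=\alpha^2/2$ for all simple roots $\alpha$ of $D$. Every Weyl chamber has exactly $7$ simple roots. There is a Weyl chamber $D$ whose simple roots are exactly $$\begin{array}{ll} \alpha_1=((\tfrac12,\tfrac12,-\tfrac12,-\tfrac12),0,0), & \alpha_2=((0,0,1,1),0,0),\\ \alpha_3=((\tfrac12,-\tfrac12,-\tfrac12,\tfrac12),0,0), & \alpha_4=((0,0,1,-1),0,0),\\ \alpha_5=((0,0,0,0),1,1), & \alpha_6=((-1,1,0,0),0,-1),\\ \alpha_7=((-1,-1,0,0),0,-1), \end{array}$$ where $\alpha_2,\alpha_4$ have norm $-6$ and the other five have norm $-2$. These are exactly the roots $\alpha$ of $L$ with $(\rho,\alpha)=\alpha^2/2$, where $\rho=((5,0,1,0),-6,7)$, of norm $\rho^2=56$, is the unique Weyl vector of $D$. The Dynkin diagram of $L$ is the chain $\alpha_2,\alpha_1,\alpha_7,\alpha_5,\alpha_6,\alpha_3,\alpha_4$ with triple bonds between $\alpha_2,\alpha_1$ and between $\alpha_3,\alpha_4$, and single bonds between the other neighbours (distinct simple roots $\alpha,\beta$ have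 $(\alpha,\beta)\ge 0$ and are joined by $4(\alpha,\beta)^2/(\alpha^2\beta^2)$ bonds). The reflection group $W$ is arithmetic and has index $2$ in $Aut(L)^+$. -/

import Mathlib

noncomputable section

namespace LorentzianLattice

/-! ## Reflection groups of Lorentzian lattices

Here `V` is a real vector space, `B` a symmetric bilinear form on it and `L` a `ℤ`-lattice in `V`,
so that `V` is `L ⊗ ℝ`. The norm of `x` is `B x x`. -/

section General

variable {V : Type*} [AddCommGroup V] [Module ℝ V]

/-- The reflection `x ↦ x - (2 (a, x) / (a, a)) a` in the hyperplane orthogonal to a vector `a` of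
nonzero norm. -/
def reflection (B : LinearMap.BilinForm ℝ V) (a : V) (ha : B a a ≠ 0) : V ≃ₗ[ℝ] V :=
  Module.reflection (x := a) (f := (2 / B a a) • B a) (by
    simp only [LinearMap.smul_apply, smul_eq_mul]
    exact div_mul_cancel₀ 2 ha)

/-- `Aut(L)`: the isometries of `V` that map `L` onto itself. When `L` spans `V` these are exactly
the (unique) extensions to `V` of the isometries of `L`. -/
def aut (B : LinearMap.BilinForm ℝ V) (L : Submodule ℤ V) : Subgroup (V ≃ₗ[ℝ] V) where
  carrier := {g | (∀ x y, B (g x) (g y) = B x y) ∧ ∀ x, g x ∈ L ↔ x ∈ L}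
  one_mem' := ⟨fun _ _ => rfl, fun _ => Iff.rfl⟩
  mul_mem' := by
    rintro g h ⟨hg, hg'⟩ ⟨hh, hh'⟩
    exact ⟨fun x y => (hg _ _).trans (hh x y), fun x => (hg' _).trans (hh' x)⟩
  inv_mem' := by
    rintro g ⟨hg, hg'⟩
    have e : ∀ x, g (g⁻¹ x) = x := fun x => g.apply_symm_apply x
    exact ⟨fun x y => by rw [← hg (g⁻¹ x) (g⁻¹ y), e, e],
      fun x => by rw [← hg' (g⁻¹ x), e]⟩

/-- The cone of positive norm vectors that contains the positive norm vector `w` (two positive norm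
vectors lie in the same one of the two cones exactly if their inner product is positive). -/
def positiveCone (B : LinearMap.BilinForm ℝ V) (w : V) : Set V :=
  {x | 0 < B x x ∧ 0 < B x w}

/-- `Aut(L)⁺`: the automorphisms of `L` that map each cone of positive norm vectors to itself. -/
def autPlus (B : LinearMap.BilinForm ℝ V) (L : Submodule ℤ V) : Subgroup (V ≃ₗ[ℝ] V) where
  carrier := {g | g ∈ aut B L ∧
    ∀ w, 0 < B w w → ∀ x, g x ∈ positiveCone B w ↔ x ∈ positiveCone B w}
  one_mem' := ⟨one_mem _, fun _ _ _ => Iff.rfl⟩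
  mul_mem' := by
    rintro g h ⟨hg, hg'⟩ ⟨hh, hh'⟩
    exact ⟨mul_mem hg hh, fun w hw x => (hg' w hw _).trans (hh' w hw x)⟩
  inv_mem' := by
    rintro g ⟨hg, hg'⟩
    have e : ∀ x, g (g⁻¹ x) = x := fun x => g.apply_symm_apply x
    exact ⟨inv_mem hg, fun w hw x => by rw [← hg' w hw (g⁻¹ x), e]⟩

/-- A root of `L`: a primitive vector of `L` of negative norm whose reflection is an automorphism
of `L`. -/
structure IsRoot (B : LinearMap.BilinForm ℝ V) (L : Submodule ℤ V) (a : V) : Prop where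
  mem : a ∈ L
  primitive : ∀ (n : ℤ), ∀ b ∈ L, a = n • b → IsUnit n
  neg : B a a < 0
  reflection_mem : reflection B a neg.ne ∈ aut B L

/-- The reflection group `W` of `L`, generated by the reflections in the roots of `L`. -/
def reflectionGroup (B : LinearMap.BilinForm ℝ V) (L : Submodule ℤ V) : Subgroup (V ≃ₗ[ℝ] V) :=
  Subgroup.closure {g | ∃ (a : V) (ha : IsRoot B L a), g = reflection B a ha.neg.ne}

/-- Hyperbolic space: the vectors of norm `1` in the cone of positive norm vectors that
contains `w`. -/
def hyperbolicSpace (B : LinearMap.BilinForm ℝ V) (w : V) : Set V :=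
  {x | B x x = 1 ∧ x ∈ positiveCone B w}

/-- An (open) Weyl chamber: a class of points of hyperbolic space that lie on no reflection
hyperplane, two points being in the same class if no reflection hyperplane separates them. -/
def IsWeylChamber (B : LinearMap.BilinForm ℝ V) (L : Submodule ℤ V) (w : V) (D : Set V) : Prop :=
  ∃ x ∈ hyperbolicSpace B w, (∀ b, IsRoot B L b → B b x ≠ 0) ∧
    D = {y | y ∈ hyperbolicSpace B w ∧ ∀ b, IsRoot B L b → 0 < B b x * B b y}

/-- A simple root of the Weyl chamber `D`: a root `a`, positive on `D`, whose hyperplane carries a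
face of `D`. The face consists of the points `y` of hyperbolic space that lie on the hyperplane of
`a` and that no other reflection hyperplane contains or separates from `D`. -/
def IsSimpleRoot (B : LinearMap.BilinForm ℝ V) (L : Submodule ℤ V) (w : V) (D : Set V)
    (a : V) : Prop :=
  IsRoot B L a ∧ (∀ x ∈ D, 0 < B a x) ∧
    ∃ y ∈ hyperbolicSpace B w, B a y = 0 ∧
      ∀ b, IsRoot B L b → b ≠ a → b ≠ -a → ∀ x ∈ D, 0 < B b x * B b y

/-- A Weyl vector for the Weyl chamber `D`: `(v, a) = a² / 2` for all simple roots `a` of `D`. -/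
def IsWeylVector (B : LinearMap.BilinForm ℝ V) (L : Submodule ℤ V) (w : V) (D : Set V)
    (v : V) : Prop :=
  ∀ a, IsSimpleRoot B L w D a → B v a = B a a / 2

/-- `Aut(D)`: the elements of `Aut(L)⁺` that map `D` onto itself. -/
def chamberAut (B : LinearMap.BilinForm ℝ V) (L : Submodule ℤ V) (D : Set V) :
    Subgroup (V ≃ₗ[ℝ] V) where
  carrier := {g | g ∈ autPlus B L ∧ ∀ x, g x ∈ D ↔ x ∈ D}
  one_mem' := ⟨one_mem _, fun _ => Iff.rfl⟩
  mul_mem' := by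
    rintro g h ⟨hg, hg'⟩ ⟨hh, hh'⟩
    exact ⟨mul_mem hg hh, fun x => (hg' _).trans (hh' x)⟩
  inv_mem' := by
    rintro g ⟨hg, hg'⟩
    have e : ∀ x, g (g⁻¹ x) = x := fun x => g.apply_symm_apply x
    exact ⟨inv_mem hg, fun x => by rw [← hg' (g⁻¹ x), e]⟩

/-- The reflection group of `L` is arithmetic: `Aut(D)` is finite for the Weyl chambers `D`. -/
def IsArithmetic (B : LinearMap.BilinForm ℝ V) (L : Submodule ℤ V) (w : V) : Prop :=
  ∀ D, IsWeylChamber B L w D → Finite (chamberAut B L D)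

/-- The number of bonds between the nodes `a` and `b` of a Dynkin diagram:
`4 (a, b)² / (a² b²)`. For `(a, b) ≥ 0` the values `0`, `1`, `3` mean that the hyperplanes of
`a` and `b` meet at the angle `π/2`, `π/3`, `π/6`. -/
def bonds (B : LinearMap.BilinForm ℝ V) (a b : V) : ℝ :=
  4 * B a b ^ 2 / (B a a * B b b)

end General

/-! ## The lattice `E_8^3(-1) ⊕ II_{1,1}` -/

/-- The scalar product on `ℝ⁴` with norm `m₁² + m₂² + 3 m₃² + 3 m₄²`. -/
def formE83 : LinearMap.BilinForm ℝ (Fin 4 → ℝ) :=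
  Matrix.toBilin' (Matrix.diagonal ![1, 1, 3, 3])

/-- `E_8^3`: the vectors `(m₁, m₂, m₃, m₄)` with all `mᵢ` in `ℤ` or all `mᵢ` in `ℤ + 1/2`, and
with `∑ mᵢ` even. -/
def latticeE83 : Submodule ℤ (Fin 4 → ℝ) where
  carrier := {m | ((∀ i, ∃ k : ℤ, m i = k) ∨ (∀ i, ∃ k : ℤ, m i = k + 1 / 2)) ∧
    ∃ k : ℤ, ∑ i, m i = 2 * k}
  zero_mem' := ⟨Or.inl fun _ => ⟨0, by simp⟩, 0, by simp⟩
  add_mem' := by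
    rintro a b ⟨ha, k, hk⟩ ⟨hb, l, hl⟩
    refine ⟨?_, k + l, by
      simp only [Pi.add_apply, Finset.sum_add_distrib, hk, hl]; push_cast; ring⟩
    rcases ha with ha | ha <;> rcases hb with hb | hb
    · refine Or.inl fun i => ?_
      obtain ⟨p, hp⟩ := ha i
      obtain ⟨q, hq⟩ := hb i
      exact ⟨p + q, by simp [hp, hq]⟩
    · refine Or.inr fun i => ?_
      obtain ⟨p, hp⟩ := ha i
      obtain ⟨q, hq⟩ := hb i
      exact ⟨p + q, by simp only [Pi.add_apply, hp, hq]; push_cast; ring⟩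
    · refine Or.inr fun i => ?_
      obtain ⟨p, hp⟩ := ha i
      obtain ⟨q, hq⟩ := hb i
      exact ⟨p + q, by simp only [Pi.add_apply, hp, hq]; push_cast; ring⟩
    · refine Or.inl fun i => ?_
      obtain ⟨p, hp⟩ := ha i
      obtain ⟨q, hq⟩ := hb i
      exact ⟨p + q + 1, by simp only [Pi.add_apply, hp, hq]; push_cast; ring⟩
  smul_mem' := by
    rintro c a ⟨ha, k, hk⟩
    refine ⟨?_, c * k, by
      simp only [Pi.smul_apply, zsmul_eq_mul, ← Finset.mul_sum, hk]; push_cast; ring⟩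
    rcases ha with ha | ha
    · refine Or.inl fun i => ?_
      obtain ⟨p, hp⟩ := ha i
      exact ⟨c * p, by simp [hp]⟩
    · rcases Int.even_or_odd' c with ⟨d, hd | hd⟩
      · refine Or.inl fun i => ?_
        obtain ⟨p, hp⟩ := ha i
        exact ⟨c * p + d, by
          simp only [Pi.smul_apply, zsmul_eq_mul, hp, hd]; push_cast; ring⟩
      · refine Or.inr fun i => ?_
        obtain ⟨p, hp⟩ := ha i
        exact ⟨c * p + d, by
          simp only [Pi.smul_apply, zsmul_eq_mul, hp, hd]; push_cast; ring⟩

/-- The scalar product of `II_{1,1}`, with norm `-2 m n`. -/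
def formII : LinearMap.BilinForm ℝ (Fin 2 → ℝ) :=
  Matrix.toBilin' !![0, -1; -1, 0]

/-- The lattice `II_{1,1}`: the integer vectors `(m, n)`. -/
def latticeII : Submodule ℤ (Fin 2 → ℝ) where
  carrier := {v | ∀ i, ∃ k : ℤ, v i = k}
  zero_mem' := fun _ => ⟨0, by simp⟩
  add_mem' := by
    intro a b ha hb i
    obtain ⟨p, hp⟩ := ha i
    obtain ⟨q, hq⟩ := hb i
    exact ⟨p + q, by simp [hp, hq]⟩
  smul_mem' := by
    intro c a ha i
    obtain ⟨p, hp⟩ := ha i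
    exact ⟨c * p, by simp [hp]⟩

/-- The real space spanned by `E_8^3(-1) ⊕ II_{1,1}`; its elements are written `(r, (m, n))`. -/
abbrev Space : Type := (Fin 4 → ℝ) × (Fin 2 → ℝ)

/-- The scalar product of `E_8^3(-1) ⊕ II_{1,1}`: the norm of `(r, (m, n))` is `-r² - 2 m n`. -/
def form : LinearMap.BilinForm ℝ Space :=
  -(formE83.compl₁₂ (LinearMap.fst ℝ _ _) (LinearMap.fst ℝ _ _)) +
    formII.compl₁₂ (LinearMap.snd ℝ _ _) (LinearMap.snd ℝ _ _)

/-- The lattice `L = E_8^3(-1) ⊕ II_{1,1}`. -/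
def lattice : Submodule ℤ Space := latticeE83.prod latticeII

theorem form_apply (x y : Space) :
    form x y = -(x.1 0 * y.1 0 + x.1 1 * y.1 1 + 3 * (x.1 2 * y.1 2) + 3 * (x.1 3 * y.1 3)) -
      (x.2 0 * y.2 1 + x.2 1 * y.2 0) := by
  simp [form, formE83, formII, Matrix.toBilin'_apply, Fin.sum_univ_succ, Matrix.diagonal]
  ring

/-- The vector `(0, 1, -1)` of norm `2`; hyperbolic space is taken in its cone. -/
def baseVector : Space := (0, ![1, -1])

/-- The vectors `α₁, …, α₇` (indexed from `0`). -/
def alpha : Fin 7 → Space :=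
  ![(![1 / 2, 1 / 2, -1 / 2, -1 / 2], ![0, 0]),
    (![0, 0, 1, 1], ![0, 0]),
    (![1 / 2, -1 / 2, -1 / 2, 1 / 2], ![0, 0]),
    (![0, 0, 1, -1], ![0, 0]),
    (![0, 0, 0, 0], ![1, 1]),
    (![-1, 1, 0, 0], ![0, -1]),
    (![-1, -1, 0, 0], ![0, -1])]

/-- The vector `ρ = ((5, 0, 1, 0), -6, 7)`. -/
def rho : Space := (![5, 0, 1, 0], ![-6, 7])

/-- The vectors `α₂, α₁, α₇, α₅, α₆, α₃, α₄`, in the order of the Dynkin diagram. -/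
def chain : Fin 7 → Space :=
  ![alpha 1, alpha 0, alpha 6, alpha 4, alpha 5, alpha 2, alpha 3]

end LorentzianLattice

end

open LorentzianLattice

namespace LorentzianLattice

/-! The core is that every root of `L` is, up to sign, a combination of the seven αᵢ with
nonnegative integer coefficients (`IsRoot.exists_sum`). Take the basis α₁, α₂, α₃, α₄, δ, α₅, where
δ = α₂ + 2α₁ + α₇ = α₄ + 2α₃ + α₆ is isotropic. A vector then has norm -2N, with N = (a² - 3ab +
3b²) + (c² - 3cd + 3d²) + q(q - p), and q is its inner product with δ. Primitivity and integrality
of the reflection force N = 1, or N = 3 with all inner products with `L` divisible by 3.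

Roots with q = 0 are roots of two copies of G₂ shifted by multiples of δ, and are checked by hand.
Roots with q > 0 are treated by descent on the height -(ρ, x), which is bounded below on them: a
simple reflection lowers the height as long as some (αᵢ, x) is negative, and a vector with all (αᵢ,
x) ≥ 0 cannot have negative norm.

Hence no root hyperplane meets the region of hyperbolic space where all αᵢ are positive, so this
region is a Weyl chamber; it contains the multiple of -ρ of norm 1. The points -ρ + αᵢ/2 give its
faces, and the αᵢ are its only simple roots. The reflection group acts transitively on chambers: for
x in hyperbolic space only finitely many lattice vectors u of norm 56 in its cone have (x, u) below
a given bound, so some image g(-ρ) minimizes (x, g(-ρ)), and minimality puts x in the closure of g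
of the chamber.

An element of Aut(L)⁺ preserving the chamber permutes the αᵢ and preserves their Gram matrix, so it
is the identity or the diagram flip. Finiteness of Aut(D) and index at most 2 follow. The index is
exactly 2 because the reflection group preserves 3L + ℤα₂, while the flip sends α₂ to α₄, which is
not in it. -/

/-! ### Positivity of roots, in integer coordinates -/

/-- The integers `(c₁, c₂, c₃, c₄, p, q)` are the coordinates of a root. -/
def IsRootCoord (a b c d p q : ℤ) : Prop :=
  a ^ 2 - 3 * a * b + 3 * b ^ 2 + (c ^ 2 - 3 * c * d + 3 * d ^ 2) + q * (q - p) = 1 ∨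
    (a ^ 2 - 3 * a * b + 3 * b ^ 2 + (c ^ 2 - 3 * c * d + 3 * d ^ 2) + q * (q - p) = 3 ∧
      3 ∣ a ∧ 3 ∣ c ∧ 3 ∣ p ∧ 3 ∣ q)

/-- The integers are the coordinates of a sum of simple roots. -/
def IsNonnegCoord (a b c d p q : ℤ) : Prop :=
  0 ≤ q ∧ ∃ n, 0 ≤ n ∧ n ≤ p ∧ 0 ≤ a + 2 * n ∧ 0 ≤ b + n ∧ 0 ≤ c + 2 * (p - n) ∧ 0 ≤ d + (p - n)

/-- The form is half the norm of aα₁ + bα₂ in a G₂ root lattice with short root α₁ and long root α₂,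
up to the sign of the norm. -/
theorem quad_nonneg (a b : ℤ) : 0 ≤ a ^ 2 - 3 * a * b + 3 * b ^ 2 := by
  nlinarith [sq_nonneg (2 * a - 3 * b), sq_nonneg b]

theorem quad_bound {a b k : ℤ} (hk : k ≤ 3) (h : a ^ 2 - 3 * a * b + 3 * b ^ 2 = k) :
    (-3 ≤ a ∧ a ≤ 3) ∧ -2 ≤ b ∧ b ≤ 2 := by
  -- Completing the square in either variable: the form is ((2a - 3b)² + 3b²)/4, and also a²/4 + 3(a
  -- - 2b)²/4.
  have hb : b ^ 2 ≤ 2 ^ 2 := by nlinarith [sq_nonneg (2 * a - 3 * b)]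
  have ha : a ^ 2 < 4 ^ 2 := by nlinarith [sq_nonneg (a - 2 * b)]
  have h1 := abs_le_of_sq_le_sq' hb (by norm_num)
  have h2 := abs_lt_of_sq_lt_sq' ha (by norm_num)
  omega

theorem quad_eq_zero {a b : ℤ} (h : a ^ 2 - 3 * a * b + 3 * b ^ 2 = 0) : a = 0 ∧ b = 0 := by
  obtain ⟨⟨h1, h2⟩, h3, h4⟩ := quad_bound (by norm_num) h
  interval_cases a <;> interval_cases b <;> simp_all

/-- A root of one of the two copies of `A₂` is a sum of simple roots up to sign, and its
coefficients are at most those of the highest root. -/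
theorem quad_root {a b : ℤ} (h : a ^ 2 - 3 * a * b + 3 * b ^ 2 = 1) :
    (0 ≤ a ∧ a ≤ 2 ∧ 0 ≤ b ∧ b ≤ 1) ∨ (0 ≤ -a ∧ -a ≤ 2 ∧ 0 ≤ -b ∧ -b ≤ 1) := by
  obtain ⟨⟨h1, h2⟩, h3, h4⟩ := quad_bound (by norm_num) h
  interval_cases a <;> interval_cases b <;> simp_all

theorem quad_long_root {a b : ℤ} (h : a ^ 2 - 3 * a * b + 3 * b ^ 2 = 3) :
    (0 ≤ a ∧ a ≤ 3 ∧ 0 ≤ b ∧ b ≤ 2) ∨ (0 ≤ -a ∧ -a ≤ 3 ∧ 0 ≤ -b ∧ -b ≤ 2) := by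
  obtain ⟨⟨h1, h2⟩, h3, h4⟩ := quad_bound (by norm_num) h
  interval_cases a <;> interval_cases b <;> simp_all

/-- When q = 0 the two nonnegative forms add up to 1, or to 3 with both divisible by 3, so one of
them vanishes and the root lies in one G₂ plus a multiple of δ. -/
theorem IsRootCoord.split {a b c d p : ℤ} (h : IsRootCoord a b c d p 0) :
    (a = 0 ∧ b = 0 ∧ c ^ 2 - 3 * c * d + 3 * d ^ 2 = 1) ∨
    (c = 0 ∧ d = 0 ∧ a ^ 2 - 3 * a * b + 3 * b ^ 2 = 1) ∨
    (3 ∣ p ∧ a = 0 ∧ b = 0 ∧ c ^ 2 - 3 * c * d + 3 * d ^ 2 = 3) ∨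
    (3 ∣ p ∧ c = 0 ∧ d = 0 ∧ a ^ 2 - 3 * a * b + 3 * b ^ 2 = 3) := by
  have h1 := quad_nonneg a b
  have h2 := quad_nonneg c d
  rcases h with h | ⟨h, ⟨a, rfl⟩, ⟨c, rfl⟩, hp, -⟩
  · rcases (by omega : a ^ 2 - 3 * a * b + 3 * b ^ 2 = 0 ∨ c ^ 2 - 3 * c * d + 3 * d ^ 2 = 0)
      with h0 | h0
    · exact Or.inl ⟨(quad_eq_zero h0).1, (quad_eq_zero h0).2, by omega⟩
    · exact Or.inr (Or.inl ⟨(quad_eq_zero h0).1, (quad_eq_zero h0).2, by omega⟩)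
  · have e1 : (3 * a) ^ 2 - 3 * (3 * a) * b + 3 * b ^ 2 = 3 * (3 * a ^ 2 - 3 * a * b + b ^ 2) := by
      ring
    have e2 : (3 * c) ^ 2 - 3 * (3 * c) * d + 3 * d ^ 2 = 3 * (3 * c ^ 2 - 3 * c * d + d ^ 2) := by
      ring
    rcases (by omega : (3 * a) ^ 2 - 3 * (3 * a) * b + 3 * b ^ 2 = 0 ∨
      (3 * c) ^ 2 - 3 * (3 * c) * d + 3 * d ^ 2 = 0) with h0 | h0
    · exact Or.inr (Or.inr (Or.inl ⟨hp, (quad_eq_zero h0).1, (quad_eq_zero h0).2, by omega⟩))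
    · exact Or.inr (Or.inr (Or.inr ⟨hp, (quad_eq_zero h0).1, (quad_eq_zero h0).2, by omega⟩))

/-- The summand pδ is expanded entirely through the copy of G₂ that contains the root, by n = 0 or n
= p. One δ contains the highest short root, which makes up for a negative short root; a long root
needs more, but there p ≥ 3. -/
theorem IsRootCoord.nonneg_of_pos {a b c d p : ℤ} (h : IsRootCoord a b c d p 0) (hp : 0 < p) :
    IsNonnegCoord a b c d p 0 := by
  rcases h.split with ⟨rfl, rfl, e⟩ | ⟨rfl, rfl, e⟩ | ⟨h3, rfl, rfl, e⟩ | ⟨h3, rfl, rfl, e⟩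
  · have := quad_root e
    exact ⟨le_rfl, 0, by omega, by omega, by omega, by omega, by omega, by omega⟩
  · have := quad_root e
    exact ⟨le_rfl, p, by omega, by omega, by omega, by omega, by omega, by omega⟩
  · have := quad_long_root e
    exact ⟨le_rfl, 0, by omega, by omega, by omega, by omega, by omega, by omega⟩
  · have := quad_long_root e
    exact ⟨le_rfl, p, by omega, by omega, by omega, by omega, by omega, by omega⟩

theorem IsRootCoord.nonneg_or_of_zero {a b c d : ℤ} (h : IsRootCoord a b c d 0 0) :
    IsNonnegCoord a b c d 0 0 ∨ IsNonnegCoord (-a) (-b) (-c) (-d) 0 0 := by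
  have key : (0 ≤ a ∧ 0 ≤ b ∧ 0 ≤ c ∧ 0 ≤ d) ∨ (0 ≤ -a ∧ 0 ≤ -b ∧ 0 ≤ -c ∧ 0 ≤ -d) := by
    rcases h.split with ⟨rfl, rfl, e⟩ | ⟨rfl, rfl, e⟩ | ⟨h3, rfl, rfl, e⟩ | ⟨h3, rfl, rfl, e⟩
    · have := quad_root e; omega
    · have := quad_root e; omega
    · have := quad_long_root e; omega
    · have := quad_long_root e; omega
  rcases key with h | h
  · exact Or.inl ⟨le_rfl, 0, by omega, by omega, by omega, by omega, by omega, by omega⟩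
  · exact Or.inr ⟨le_rfl, 0, by omega, by omega, by omega, by omega, by omega, by omega⟩

theorem IsRootCoord.neg {a b c d p q : ℤ} (h : IsRootCoord a b c d p q) :
    IsRootCoord (-a) (-b) (-c) (-d) (-p) (-q) := by
  rcases h with h | ⟨h, h1, h2, h3, h4⟩
  · exact Or.inl (by linear_combination h)
  · exact Or.inr ⟨by linear_combination h, h1.neg_right, h2.neg_right, h3.neg_right, h4.neg_right⟩

/-- Adding `key` for both copies of G₂ and inserting N ≤ 3 gives 2q · height ≥ -36. This makes the
descent terminate. -/
theorem IsRootCoord.height_bound {a b c d p q : ℤ} (h : IsRootCoord a b c d p q) (hq : 0 < q) :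
    -18 ≤ a + 3 * b + c + 3 * d + 6 * p + q := by
  by_contra! hlt
  have h1 : a ^ 2 - 3 * a * b + 3 * b ^ 2 + (c ^ 2 - 3 * c * d + 3 * d ^ 2) + q * (q - p) ≤ 3 := by
    rcases h with h | h <;> omega
  have key : ∀ x y : ℤ, 0 ≤ 12 * (x ^ 2 - 3 * x * y + 3 * y ^ 2) + 2 * q * (x + 3 * y) + 7 * q ^ 2 := by
    intro x y
    nlinarith [sq_nonneg (12 * (2 * x - 3 * y) + 2 * q), sq_nonneg (2 * y + q), sq_nonneg q]
  have h2 := key a b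
  have h3 := key c d
  nlinarith

/-- The cone on which all simple roots are nonnegative contains no vectors of negative norm. -/
theorem not_isRootCoord_of_dominant {a b c d p q : ℤ} (h1 : 0 ≤ -2 * a + 3 * b)
    (h2 : 0 ≤ a - 2 * b) (h3 : 0 ≤ -2 * c + 3 * d) (h4 : 0 ≤ c - 2 * d) (h5 : 0 ≤ p - 2 * q)
    (h6 : 0 ≤ q + c) (h7 : 0 ≤ q + a) : ¬ IsRootCoord a b c d p q := by
  intro h
  have hpos : 1 ≤ a ^ 2 - 3 * a * b + 3 * b ^ 2 + (c ^ 2 - 3 * c * d + 3 * d ^ 2) + q * (q - p) := by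
    rcases h with h | h <;> omega
  have key : ∀ x y : ℤ, 0 ≤ -2 * x + 3 * y → 0 ≤ x - 2 * y → 0 ≤ q + x →
      3 * (x ^ 2 - 3 * x * y + 3 * y ^ 2) ≤ q ^ 2 := by
    intro x y h1 h2 h3
    -- The hypotheses give -q ≤ x ≤ 0 and 0 ≤ 3x - 6y ≤ -x ≤ q; moreover 12(x² - 3xy + 3y²) = 3x² +
    -- (3x - 6y)². Together with q(q - p) ≤ -q² this makes N at most -q²/3.
    have e1 : x ^ 2 ≤ q ^ 2 := by nlinarith
    have e2 : (3 * x - 6 * y) ^ 2 ≤ q ^ 2 := by nlinarith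
    nlinarith
  have k1 := key a b h1 h2 h7
  have k2 := key c d h3 h4 h6
  nlinarith

theorem IsRootCoord.nonneg {a b c d p q : ℤ} (h : IsRootCoord a b c d p q) (hq : 0 < q) :
    IsNonnegCoord a b c d p q := by
  obtain ⟨n, hn⟩ : ∃ n : ℕ, a + 3 * b + c + 3 * d + 6 * p + q + 18 < n :=
    ⟨(a + 3 * b + c + 3 * d + 6 * p + q + 19).toNat, by omega⟩
  induction n generalizing a b c d p q with
  | zero => have := h.height_bound hq; omega
  | succ n ih =>
    -- The conditions `h1` to `h7` say that (αᵢ, x) ≥ 0. If one fails, reflecting in αᵢ subtracts a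
    -- positive multiple of αᵢ; the coefficients found for the reflected root then serve for x, with
    -- only that of αᵢ increased.
    by_cases h1 : 0 ≤ -2 * a + 3 * b
    swap
    · obtain ⟨-, m, hm⟩ := ih (a := -a + 3 * b) (b := b) (c := c) (d := d) (p := p) (q := q) (by
        rcases h with h | ⟨h, h1, h2, h3, h4⟩
        · exact Or.inl (by linear_combination h)
        · exact Or.inr ⟨by linear_combination h, by omega, h2, h3, h4⟩) hq (by omega)
      exact ⟨hq.le, m, by omega, by omega, by omega, by omega, by omega, by omega⟩
    by_cases h2 : 0 ≤ a - 2 * b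
    swap
    · obtain ⟨-, m, hm⟩ := ih (a := a) (b := a - b) (c := c) (d := d) (p := p) (q := q) (by
        rcases h with h | ⟨h, h1, h2, h3, h4⟩
        · exact Or.inl (by linear_combination h)
        · exact Or.inr ⟨by linear_combination h, h1, h2, h3, h4⟩) hq (by omega)
      exact ⟨hq.le, m, by omega, by omega, by omega, by omega, by omega, by omega⟩
    by_cases h3 : 0 ≤ -2 * c + 3 * d
    swap
    · obtain ⟨-, m, hm⟩ := ih (a := a) (b := b) (c := -c + 3 * d) (d := d) (p := p) (q := q) (by
        rcases h with h | ⟨h, h1, h2, h3, h4⟩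
        · exact Or.inl (by linear_combination h)
        · exact Or.inr ⟨by linear_combination h, h1, by omega, h3, h4⟩) hq (by omega)
      exact ⟨hq.le, m, by omega, by omega, by omega, by omega, by omega, by omega⟩
    by_cases h4 : 0 ≤ c - 2 * d
    swap
    · obtain ⟨-, m, hm⟩ := ih (a := a) (b := b) (c := c) (d := c - d) (p := p) (q := q) (by
        rcases h with h | ⟨h, h1, h2, h3, h4⟩
        · exact Or.inl (by linear_combination h)
        · exact Or.inr ⟨by linear_combination h, h1, h2, h3, h4⟩) hq (by omega)
      exact ⟨hq.le, m, by omega, by omega, by omega, by omega, by omega, by omega⟩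
    by_cases h6 : 0 ≤ q + c
    swap
    · obtain ⟨-, m, hm⟩ := ih (a := a) (b := b) (c := c - 2 * (q + c)) (d := d - (q + c))
        (p := p + (q + c)) (q := q) (by
        rcases h with h | ⟨h, h1, h2, h3, h4⟩
        · exact Or.inl (by linear_combination h)
        · exact Or.inr ⟨by linear_combination h, h1, by omega, by omega, h4⟩) hq (by omega)
      exact ⟨hq.le, m, by omega, by omega, by omega, by omega, by omega, by omega⟩
    by_cases h7 : 0 ≤ q + a
    swap
    · obtain ⟨-, m, hm⟩ := ih (a := a - 2 * (q + a)) (b := b - (q + a)) (c := c) (d := d)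
        (p := p + (q + a)) (q := q) (by
        rcases h with h | ⟨h, h1, h2, h3, h4⟩
        · exact Or.inl (by linear_combination h)
        · exact Or.inr ⟨by linear_combination h, by omega, h2, by omega, h4⟩) hq (by omega)
      -- The parameter of `IsNonnegCoord` is the coefficient of α₇, so this reflection is the only
      -- one that moves it.
      exact ⟨hq.le, m - (q + a), by omega, by omega, by omega, by omega, by omega, by omega⟩
    by_cases h5 : 0 ≤ p - 2 * q
    · exact absurd h (not_isRootCoord_of_dominant h1 h2 h3 h4 h5 h6 h7)
    -- Reflection in α₅ replaces q by p - q and may leave the region q > 0. The part of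
    -- `IsNonnegCoord` after `0 ≤ q` does not involve q, so it carries over.
    have hs : IsRootCoord a b c d p (p - q) := by
      rcases h with h | ⟨h, h1, h2, h3, h4⟩
      · exact Or.inl (by linear_combination h)
      · exact Or.inr ⟨by linear_combination h, h1, h2, h3, by omega⟩
    rcases lt_trichotomy 0 (p - q) with hpq | hpq | hpq
    · exact ⟨hq.le, (ih hs hpq (by omega)).2⟩
    · rw [← hpq] at hs
      exact ⟨hq.le, (hs.nonneg_of_pos (by omega)).2⟩
    · have n1 := quad_nonneg a b
      have n2 := quad_nonneg c d
      -- Here q and q - p are both positive. For N = 1 this leaves α₅ itself; for N = 3 both are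
      -- multiples of 3, so their product is at least 9.
      rcases h with h | ⟨h, -, -, h3, h4⟩
      · have hle : q * (q - p) ≤ 1 := by omega
        have hq1 : q = 1 := by nlinarith
        have hp0 : p = 0 := by subst hq1; omega
        subst hq1 hp0
        obtain ⟨rfl, rfl⟩ := quad_eq_zero (a := a) (b := b) (by omega)
        obtain ⟨rfl, rfl⟩ := quad_eq_zero (a := c) (b := d) (by omega)
        exact ⟨hq.le, 0, by simp⟩
      · have : 3 ≤ q := by omega
        have : 3 ≤ q - p := by omega
        nlinarith

/-- Every root is, up to sign, a sum of simple roots. -/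
theorem IsRootCoord.nonneg_or {a b c d p q : ℤ} (h : IsRootCoord a b c d p q) :
    IsNonnegCoord a b c d p q ∨ IsNonnegCoord (-a) (-b) (-c) (-d) (-p) (-q) := by
  rcases lt_trichotomy 0 q with hq | rfl | hq
  · exact Or.inl (h.nonneg hq)
  · rcases lt_trichotomy 0 p with hp | rfl | hp
    · exact Or.inl (h.nonneg_of_pos hp)
    · simpa using h.nonneg_or_of_zero
    · have := h.neg
      rw [neg_zero] at this ⊢
      exact Or.inr (this.nonneg_of_pos (by omega))
  · exact Or.inr (h.neg.nonneg (by omega))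

/-! ### Reflections and their conjugates -/

section General

variable {V : Type*} [AddCommGroup V] [Module ℝ V] {B : LinearMap.BilinForm ℝ V}
  {L : Submodule ℤ V}

theorem reflection_apply {a : V} (ha : B a a ≠ 0) (x : V) :
    reflection B a ha x = x - (2 / B a a * B a x) • a := by
  simp [reflection, Module.reflection_apply]

theorem reflection_involutive {a : V} (ha : B a a ≠ 0) (x : V) :
    reflection B a ha (reflection B a ha x) = x :=
  Module.involutive_reflection _ x

theorem reflection_isometry (hB : ∀ x y, B x y = B y x) {a : V} (ha : B a a ≠ 0) (x y : V) :
    B (reflection B a ha x) (reflection B a ha y) = B x y := by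
  simp only [reflection_apply, map_sub, map_smul, LinearMap.sub_apply, LinearMap.smul_apply,
    smul_eq_mul, hB x a]
  field_simp
  ring

theorem aut_apply_reflection {g : V ≃ₗ[ℝ] V} (hg : g ∈ aut B L) {a : V} (ha : B a a ≠ 0)
    (ha' : B (g a) (g a) ≠ 0) : reflection B (g a) ha' = g * reflection B a ha * g⁻¹ := by
  ext x
  obtain ⟨y, rfl⟩ := g.surjective x
  have e : g⁻¹ (g y) = y := g.symm_apply_apply y
  simp only [LinearEquiv.mul_apply, e, reflection_apply, map_sub, map_smul, hg.1]

theorem IsRoot.map {g : V ≃ₗ[ℝ] V} (hg : g ∈ aut B L) {a : V} (ha : IsRoot B L a) :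
    IsRoot B L (g a) where
  mem := (hg.2 a).2 ha.mem
  primitive n b hb h := by
    have hg' := (aut B L).inv_mem hg
    refine ha.primitive n (g⁻¹ b) ((hg'.2 b).2 hb) ?_
    rw [← map_zsmul, ← h]
    exact (g.symm_apply_apply a).symm
  neg := by rw [hg.1]; exact ha.neg
  reflection_mem := by
    rw [aut_apply_reflection hg ha.neg.ne]
    exact mul_mem (mul_mem hg ha.reflection_mem) (inv_mem hg)

end General

/-! ### Coordinates on the lattice and classification of its roots -/

theorem form_comm (x y : Space) : form x y = form y x := by
  rw [form_apply, form_apply]; ring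

/-- The vector of `L` with given coordinates with respect to the basis
`α₁, α₂, α₃, α₄, α₂ + 2 α₁ + α₇, α₅`. -/
noncomputable def vec (a b c d p q : ℤ) : Space :=
  (![((a : ℝ) + c) / 2, ((a : ℝ) - c) / 2, -((a : ℝ) + c) / 2 + b + d, ((c : ℝ) - a) / 2 + b - d],
    ![q, (q : ℝ) - p])

theorem mem_lattice_iff (x : Space) :
    x ∈ lattice ↔ ∃ a b c d p q : ℤ, x = vec a b c d p q := by
  constructor
  · rintro ⟨⟨h, s, hs⟩, h2⟩
    obtain ⟨q, hq⟩ := h2 0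
    obtain ⟨n, hn⟩ := h2 1
    rw [Fin.sum_univ_four] at hs
    have key : ∃ u v w : ℤ, x.1 0 + x.1 1 = u ∧ x.1 0 - x.1 1 = v ∧ x.1 1 + x.1 3 = w := by
      rcases h with h | h
      · obtain ⟨i, hi⟩ := h 0
        obtain ⟨j, hj⟩ := h 1
        obtain ⟨k, hk⟩ := h 3
        exact ⟨i + j, i - j, j + k, by simp [hi, hj], by simp [hi, hj], by simp [hj, hk]⟩
      · obtain ⟨i, hi⟩ := h 0
        obtain ⟨j, hj⟩ := h 1
        obtain ⟨k, hk⟩ := h 3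
        exact ⟨i + j + 1, i - j, j + k + 1, by rw [hi, hj]; push_cast; ring,
          by rw [hi, hj]; push_cast; ring, by rw [hk, hj]; push_cast; ring⟩
    obtain ⟨u, v, w, hu, hv, hw⟩ := key
    -- Solving for the coordinates: a = m₁ + m₂, c = m₁ - m₂, b is half the sum of the mᵢ, and d = b
    -- - (m₂ + m₄).
    refine ⟨u, s, v, s - w, q - n, q, Prod.ext (funext fun i => ?_) (funext fun i => ?_)⟩
    · fin_cases i <;> simp [vec] <;> linarith
    · fin_cases i <;> simp [vec, hq, hn]
  · rintro ⟨a, b, c, d, p, q, rfl⟩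
    refine ⟨⟨?_, b, by simp [vec, Fin.sum_univ_four]; ring⟩, fun i => ?_⟩
    · rcases Int.even_or_odd' (a + c) with ⟨k, hk | hk⟩
      · obtain rfl : a = 2 * k - c := by omega
        refine Or.inl fun i => ?_
        fin_cases i
        · exact ⟨k, by simp [vec]⟩
        · exact ⟨k - c, by simp [vec]; ring⟩
        · exact ⟨-k + b + d, by simp [vec]; ring⟩
        · exact ⟨c - k + b - d, by simp [vec]; ring⟩
      · obtain rfl : a = 2 * k + 1 - c := by omega
        refine Or.inr fun i => ?_
        fin_cases i
        · exact ⟨k, by simp [vec]; ring⟩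
        · exact ⟨k - c, by simp [vec]; ring⟩
        · exact ⟨-k + b + d - 1, by simp [vec]; ring⟩
        · exact ⟨c - k + b - d - 1, by simp [vec]; ring⟩
    · fin_cases i
      · exact ⟨q, by simp [vec]⟩
      · exact ⟨q - p, by simp [vec]⟩

theorem form_vec_vec (a b c d p q a' b' c' d' p' q' : ℤ) :
    form (vec a b c d p q) (vec a' b' c' d' p' q') =
      ((a * (-2 * a' + 3 * b') + b * (3 * a' - 6 * b') + c * (-2 * c' + 3 * d') +
        d * (3 * c' - 6 * d') + p * q' + q * (p' - 2 * q') : ℤ) : ℝ) := by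
  simp [form_apply, vec]
  ring

theorem form_vec_self (a b c d p q : ℤ) :
    form (vec a b c d p q) (vec a b c d p q) =
      -2 * ((a ^ 2 - 3 * a * b + 3 * b ^ 2 + (c ^ 2 - 3 * c * d + 3 * d ^ 2) + q * (q - p) : ℤ) : ℝ)
      := by
  rw [form_vec_vec]; push_cast; ring

theorem smul_vec (n a b c d p q : ℤ) :
    n • vec a b c d p q = vec (n * a) (n * b) (n * c) (n * d) (n * p) (n * q) := by
  refine Prod.ext (funext fun i => ?_) (funext fun i => ?_) <;> fin_cases i <;> simp [vec] <;> ring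

/-- A vector of norm `-2 k`, with `k` equal to `1` or `3`, is a root if its inner products with `L`
are divisible by `k`. -/
theorem isRoot_of_dvd {x : Space} {k : ℤ} (hx : x ∈ lattice) (hk : k = 1 ∨ k = 3)
    (hn : form x x = -2 * k) (hd : ∀ y ∈ lattice, ∃ n : ℤ, form x y = k * n) :
    IsRoot form lattice x := by
  have hk0 : (0 : ℝ) < k := by rcases hk with rfl | rfl <;> norm_num
  have hneg : form x x < 0 := by rw [hn]; linarith
  refine ⟨hx, ?_, hneg, fun y z => reflection_isometry form_comm _ y z, ?_⟩
  · intro n y hy hxy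
    obtain ⟨a, b, c, d, p, q, rfl⟩ := (mem_lattice_iff y).1 hy
    rw [hxy, smul_vec, form_vec_self] at hn
    have hn' : n * n * (a ^ 2 - 3 * a * b + 3 * b ^ 2 + (c ^ 2 - 3 * c * d + 3 * d ^ 2) +
        q * (q - p)) = k := by
      have : (-2 : ℝ) ≠ 0 := by norm_num
      have h := Int.cast_injective (mul_left_cancel₀ this hn)
      rw [← h]; ring
    -- Primitivity holds because k is squarefree.
    have hdvd : n * n ∣ k := Dvd.intro _ hn'
    rcases hk with rfl | rfl
    · exact isUnit_of_dvd_one ((dvd_mul_right n n).trans hdvd)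
    · exact Int.prime_three.squarefree n hdvd
  · have key : ∀ y ∈ lattice, reflection form x hneg.ne y ∈ lattice := by
      intro y hy
      obtain ⟨n, h⟩ := hd y hy
      rw [reflection_apply, h, hn, show (2 / (-2 * (k : ℝ)) * (k * n)) = ((-n : ℤ) : ℝ) by
        push_cast; field_simp, Int.cast_smul_eq_zsmul]
      exact sub_mem hy (lattice.smul_mem _ hx)
    intro y
    refine ⟨fun h => ?_, key y⟩
    have := key _ h
    rwa [reflection_involutive] at this

theorem alpha_eq_vec (i : Fin 7) : alpha i = vec (![1, 0, 0, 0, 0, 0, -2] i)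
    (![0, 1, 0, 0, 0, 0, -1] i) (![0, 0, 1, 0, 0, -2, 0] i) (![0, 0, 0, 1, 0, -1, 0] i)
    (![0, 0, 0, 0, 0, 1, 1] i) (![0, 0, 0, 0, 1, 0, 0] i) := by
  refine Prod.ext (funext fun j => ?_) (funext fun j => ?_) <;> fin_cases i <;> fin_cases j <;>
    simp [vec, alpha]

theorem form_alpha_self (i : Fin 7) :
    form (alpha i) (alpha i) = if i = 1 ∨ i = 3 then -6 else -2 := by
  fin_cases i <;> simp [form_apply, alpha] <;> norm_num

theorem alpha_mem (i : Fin 7) : alpha i ∈ lattice :=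
  (mem_lattice_iff _).2 ⟨_, _, _, _, _, _, alpha_eq_vec i⟩

theorem isRoot_alpha (i : Fin 7) : IsRoot form lattice (alpha i) := by
  by_cases hi : i = 1 ∨ i = 3
  · refine isRoot_of_dvd (k := 3) (alpha_mem i) (Or.inr rfl)
      (by rw [form_alpha_self, if_pos hi]; norm_num) fun y hy => ?_
    obtain ⟨a, b, c, d, p, q, rfl⟩ := (mem_lattice_iff y).1 hy
    rw [alpha_eq_vec, form_vec_vec]
    rcases hi with rfl | rfl
    · exact ⟨a - 2 * b, by simp; ring⟩
    · exact ⟨c - 2 * d, by simp; ring⟩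
  · refine isRoot_of_dvd (k := 1) (alpha_mem i) (Or.inl rfl)
      (by rw [form_alpha_self, if_neg hi]; norm_num) fun y hy => ?_
    obtain ⟨a, b, c, d, p, q, rfl⟩ := (mem_lattice_iff y).1 hy
    rw [alpha_eq_vec, form_vec_vec, Int.cast_one]
    simp only [one_mul]
    exact ⟨_, rfl⟩

/-- Integrality of the reflection puts (M/N)x in `L`. With M/N = m/n in lowest terms, a Bézout
relation um + vn = 1 writes x as n times the lattice vector u(m/n)x + vx, so n is a unit by
primitivity. -/
theorem dvd_of_isRoot {x : Space} (hx : IsRoot form lattice x) {N : ℤ} (hN : form x x = -2 * N)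
    {y : Space} (hy : y ∈ lattice) {M : ℤ} (hM : form x y = M) : N ∣ M := by
  have hN0 : (N : ℝ) ≠ 0 := fun h => hx.neg.ne (by rw [hN, h]; ring)
  have h1 := (hx.reflection_mem.2 y).2 hy
  rw [reflection_apply, hN, hM] at h1
  have h2 : ((M : ℝ) / N) • x ∈ lattice := by
    have := sub_mem h1 hy
    rwa [sub_sub_cancel_left, ← neg_smul, show -(2 / (-2 * (N : ℝ)) * M) = M / N by
      field_simp] at this
  have hN' : N ≠ 0 := by exact_mod_cast hN0
  obtain ⟨g, m, n, hg, hcop, rfl, rfl⟩ := Int.exists_gcd_one' (m := M) (n := N)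
    (Int.gcd_pos_of_ne_zero_right _ hN')
  obtain ⟨u, v, huv⟩ := Int.isCoprime_iff_gcd_eq_one.2 hcop
  have hn : (n : ℝ) ≠ 0 := by
    rintro h; apply hN0; push_cast; rw [h, zero_mul]
  have hg0 : (g : ℝ) ≠ 0 := by exact_mod_cast hg.ne'
  set z := (((m * g : ℤ) : ℝ) / ((n * g : ℤ) : ℝ)) • x with hz
  have hzx : n • z = m • x := by
    rw [hz, ← Int.cast_smul_eq_zsmul ℝ n, ← Int.cast_smul_eq_zsmul ℝ m, smul_smul]
    congr 1
    push_cast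
    field_simp
  have hu : IsUnit n := by
    refine hx.primitive n (u • z + v • x)
      (add_mem (lattice.smul_mem _ h2) (lattice.smul_mem _ hx.mem)) ?_
    rw [smul_add, smul_comm n u, hzx, smul_comm n v, smul_smul, smul_smul, ← add_smul, huv, one_smul]
  exact mul_dvd_mul_right hu.dvd _

theorem IsRoot.exists_coord {x : Space} (hx : IsRoot form lattice x) :
    ∃ a b c d p q : ℤ, x = vec a b c d p q ∧ IsRootCoord a b c d p q := by
  obtain ⟨a, b, c, d, p, q, rfl⟩ := (mem_lattice_iff x).1 hx.mem
  refine ⟨a, b, c, d, p, q, rfl, ?_⟩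
  have hpos := hx.neg
  rw [form_vec_self] at hpos
  have hprim : ∀ n, n ∣ a → n ∣ b → n ∣ c → n ∣ d → n ∣ p → n ∣ q → IsUnit n := by
    rintro n ⟨a, rfl⟩ ⟨b, rfl⟩ ⟨c, rfl⟩ ⟨d, rfl⟩ ⟨p, rfl⟩ ⟨q, rfl⟩
    exact hx.primitive n _ ((mem_lattice_iff _).2 ⟨_, _, _, _, _, _, rfl⟩) (smul_vec ..).symm
  have hdvd := fun a' b' c' d' p' q' => dvd_of_isRoot hx (form_vec_self ..)
    ((mem_lattice_iff _).2 ⟨a', b', c', d', p', q', rfl⟩) (form_vec_vec ..)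
  unfold IsRootCoord
  generalize a ^ 2 - 3 * a * b + 3 * b ^ 2 + (c ^ 2 - 3 * c * d + 3 * d ^ 2) + q * (q - p) = N
    at hpos hdvd ⊢
  have hN : 0 < N := by
    have : (0 : ℝ) < N := by linarith
    exact_mod_cast this
  -- Testing against the basis shows that N divides a, c, p, q, 3b and 3d. So N, or N/3 when 3
  -- divides N, divides every coordinate and is 1.
  have d1 := hdvd 1 0 0 0 0 0
  have d2 := hdvd 0 1 0 0 0 0
  have d3 := hdvd 0 0 1 0 0 0
  have d4 := hdvd 0 0 0 1 0 0
  have d5 := hdvd 0 0 0 0 1 0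
  have d6 := hdvd 0 0 0 0 0 1
  ring_nf at d1 d2 d3 d4 d5 d6
  have hp : N ∣ p := by
    have := d6.add (d5.mul_left 2)
    ring_nf at this
    exact this
  have ha : N ∣ a := by
    have := (d1.mul_left 2).add d2
    ring_nf at this
    simpa using this
  have hc : N ∣ c := by
    have := (d3.mul_left 2).add d4
    ring_nf at this
    simpa using this
  have hb : N ∣ 3 * b := by
    have := d1.add (ha.mul_left 2)
    ring_nf at this
    rwa [mul_comm]
  have hd : N ∣ 3 * d := by
    have := d3.add (hc.mul_left 2)
    ring_nf at this
    rwa [mul_comm]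
  by_cases h3 : (3 : ℤ) ∣ N
  · obtain ⟨n, rfl⟩ := h3
    have hn : ∀ {m}, 3 * n ∣ m → n ∣ m := fun h => (Dvd.intro_left _ rfl).trans h
    have := hprim n (hn ha) (Int.dvd_of_mul_dvd_mul_left (by norm_num) hb) (hn hc)
      (Int.dvd_of_mul_dvd_mul_left (by norm_num) hd) (hn hp) (hn d5)
    have h1 : n = 1 := by
      rcases Int.isUnit_iff.1 this with h | h <;> omega
    subst h1
    exact Or.inr ⟨rfl, ha, hc, hp, d5⟩
  · have hcop : IsCoprime N 3 := ((Int.prime_three.coprime_iff_not_dvd).2 h3).symm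
    have := hprim N ha (hcop.dvd_of_dvd_mul_left hb) hc (hcop.dvd_of_dvd_mul_left hd) hp d5
    left
    rcases Int.isUnit_iff.1 this with h | h <;> omega

theorem IsNonnegCoord.exists_sum {a b c d p q : ℤ} (h : IsNonnegCoord a b c d p q) :
    ∃ n : Fin 7 → ℤ, (∀ i, 0 ≤ n i) ∧ vec a b c d p q = ∑ i, n i • alpha i := by
  obtain ⟨hq, m, h0, h1, h2, h3, h4, h5⟩ := h
  -- Of the p copies of δ, m are expanded as α₂ + 2α₁ + α₇ and p - m as α₄ + 2α₃ + α₆.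
  refine ⟨![a + 2 * m, b + m, c + 2 * (p - m), d + (p - m), q, p - m, m], ?_, ?_⟩
  · intro i
    fin_cases i <;> simp <;> omega
  · refine Prod.ext (funext fun i => ?_) (funext fun i => ?_) <;> fin_cases i <;>
      simp [vec, alpha, Fin.sum_univ_succ] <;> ring

/-- Every root is, up to sign, a sum of simple roots. -/
theorem IsRoot.exists_sum {x : Space} (hx : IsRoot form lattice x) :
    ∃ n : Fin 7 → ℤ, (∀ i, 0 ≤ n i) ∧ (x = ∑ i, n i • alpha i ∨ x = -∑ i, n i • alpha i) := by
  obtain ⟨a, b, c, d, p, q, rfl, h⟩ := hx.exists_coord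
  rcases h.nonneg_or with h | h
  · obtain ⟨n, hn, e⟩ := h.exists_sum
    exact ⟨n, hn, Or.inl e⟩
  · obtain ⟨n, hn, e⟩ := h.exists_sum
    refine ⟨n, hn, Or.inr ?_⟩
    rw [← e, ← neg_one_smul ℤ, smul_vec]
    simp

/-! ### Action of automorphisms on chambers and simple roots -/

section General

variable {V : Type*} [AddCommGroup V] [Module ℝ V] {B : LinearMap.BilinForm ℝ V}
  {L : Submodule ℤ V} {w : V} {g : V ≃ₗ[ℝ] V}

theorem inv_apply_self (g : V ≃ₗ[ℝ] V) (x : V) : g⁻¹ (g x) = x := g.symm_apply_apply x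

theorem apply_inv_self (g : V ≃ₗ[ℝ] V) (x : V) : g (g⁻¹ x) = x := g.apply_symm_apply x

theorem mem_image_iff (D : Set V) (x : V) : x ∈ g '' D ↔ g⁻¹ x ∈ D := by
  refine ⟨?_, fun h => ⟨_, h, apply_inv_self g x⟩⟩
  rintro ⟨y, hy, rfl⟩
  rwa [inv_apply_self]

theorem aut_apply_inv (hg : g ∈ aut B L) (x y : V) : B (g⁻¹ x) y = B x (g y) := by
  rw [← hg.1, apply_inv_self]

theorem mem_hyperbolicSpace_iff_of_mem_autPlus (hw : 0 < B w w) (hg : g ∈ autPlus B L) (x : V) :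
    g x ∈ hyperbolicSpace B w ↔ x ∈ hyperbolicSpace B w :=
  and_congr (by rw [hg.1.1]) (hg.2 w hw x)

/-- Any point of a chamber can serve as its base point, so two chambers with a common point are
equal. -/
theorem IsWeylChamber.eq_of_mem {D : Set V} (hD : IsWeylChamber B L w D) {x : V} (hx : x ∈ D) :
    D = {y | y ∈ hyperbolicSpace B w ∧ ∀ b, IsRoot B L b → 0 < B b x * B b y} := by
  obtain ⟨z, -, -, rfl⟩ := hD
  ext y
  refine and_congr_right fun _ => forall₂_congr fun b hb => ?_
  have h := hx.2 b hb
  constructor <;> intro h' <;> rcases pos_and_pos_or_neg_and_neg_of_mul_pos h with ⟨h1, h2⟩ | ⟨h1, h2⟩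
  · exact mul_pos h2 (pos_of_mul_pos_right h' h1.le)
  · exact mul_pos_of_neg_of_neg h2 (neg_of_mul_pos_right h' h1.le)
  · exact mul_pos h1 (pos_of_mul_pos_right h' h2.le)
  · exact mul_pos_of_neg_of_neg h1 (neg_of_mul_pos_right h' h2.le)

theorem IsWeylChamber.image (hw : 0 < B w w) (hg : g ∈ autPlus B L) {D : Set V}
    (hD : IsWeylChamber B L w D) : IsWeylChamber B L w (g '' D) := by
  obtain ⟨x, hx, hx', rfl⟩ := hD
  have hgi := inv_mem hg
  refine ⟨g x, (mem_hyperbolicSpace_iff_of_mem_autPlus hw hg x).2 hx, fun b hb => ?_, ?_⟩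
  · rw [← aut_apply_inv hg.1]
    exact hx' _ (hb.map hgi.1)
  · ext y
    rw [mem_image_iff]
    refine and_congr (mem_hyperbolicSpace_iff_of_mem_autPlus hw hgi y) ⟨fun h b hb => ?_,
      fun h b hb => ?_⟩
    · have := h _ (hb.map hgi.1)
      rwa [aut_apply_inv hg.1, aut_apply_inv hg.1, apply_inv_self] at this
    · have := h _ (hb.map hg.1)
      rwa [← aut_apply_inv hg.1, inv_apply_self, ← hg.1.1, ← hg.1.1 b, apply_inv_self] at *

theorem IsSimpleRoot.image (hw : 0 < B w w) (hg : g ∈ autPlus B L) {D : Set V} {a : V}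
    (ha : IsSimpleRoot B L w D a) : IsSimpleRoot B L w (g '' D) (g a) := by
  obtain ⟨hr, hpos, y, hy, hay, h⟩ := ha
  refine ⟨hr.map hg.1, ?_, g y, (mem_hyperbolicSpace_iff_of_mem_autPlus hw hg y).2 hy, ?_, ?_⟩
  · rintro _ ⟨x, hx, rfl⟩
    rw [hg.1.1]
    exact hpos x hx
  · rwa [hg.1.1]
  · rintro b hb h1 h2 _ ⟨x, hx, rfl⟩
    rw [← aut_apply_inv hg.1, ← aut_apply_inv hg.1]
    refine h _ (hb.map (inv_mem hg.1)) ?_ ?_ x hx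
    · rintro rfl; exact h1 (apply_inv_self g b).symm
    · intro h; apply h2; rw [← map_neg, ← h, apply_inv_self]

theorem setOf_isSimpleRoot_image (hw : 0 < B w w) (hg : g ∈ autPlus B L) (D : Set V) :
    {a | IsSimpleRoot B L w (g '' D) a} = g '' {a | IsSimpleRoot B L w D a} := by
  ext a
  rw [mem_image_iff]
  refine ⟨fun h => ?_, fun h => ?_⟩
  · have := IsSimpleRoot.image hw (inv_mem hg) h
    rwa [Set.image_image, show (fun x => g⁻¹ (g x)) = id from funext (inv_apply_self g),
      Set.image_id] at this
  · have := IsSimpleRoot.image hw hg h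
    rwa [apply_inv_self] at this

end General

/-! ### The two cones of positive norm vectors -/

/-- An explicit reversed Cauchy–Schwarz inequality: for positive norms the right side is positive.
It makes the sign of the first `II_{1,1}` coordinate tell the cones apart, and later bounds u in
terms of (x, u). -/
theorem cone_identity (x y : Space) : 2 * x.2 0 * y.2 0 * form x y =
    y.2 0 ^ 2 * form x x + x.2 0 ^ 2 * form y y + ((y.2 0 * x.1 0 - x.2 0 * y.1 0) ^ 2 +
      (y.2 0 * x.1 1 - x.2 0 * y.1 1) ^ 2 + 3 * (y.2 0 * x.1 2 - x.2 0 * y.1 2) ^ 2 +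
      3 * (y.2 0 * x.1 3 - x.2 0 * y.1 3) ^ 2) := by
  simp only [form_apply]; ring

theorem ne_zero_of_form_pos {x : Space} (hx : 0 < form x x) : x.2 0 ≠ 0 := by
  intro h
  rw [form_apply, h] at hx
  nlinarith [sq_nonneg (x.1 0), sq_nonneg (x.1 1), sq_nonneg (x.1 2), sq_nonneg (x.1 3)]

theorem form_pos_iff {x y : Space} (hx : 0 < form x x) (hy : 0 < form y y) :
    0 < form x y ↔ 0 < x.2 0 * y.2 0 := by
  have h1 : 0 < y.2 0 ^ 2 * form x x :=
    mul_pos (sq_pos_of_ne_zero (ne_zero_of_form_pos hy)) hx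
  have h2 : 0 ≤ x.2 0 ^ 2 * form y y := by positivity
  have h : 0 < (x.2 0 * y.2 0) * form x y := by
    have := cone_identity x y
    have : 0 < 2 * x.2 0 * y.2 0 * form x y := by rw [this]; positivity
    linarith
  exact ⟨fun h' => pos_of_mul_pos_left h h'.le, fun h' => pos_of_mul_pos_right h h'.le⟩

theorem form_baseVector : form baseVector baseVector = 2 := by
  simp [form_apply, baseVector]; norm_num

theorem baseVector_pos : 0 < form baseVector baseVector := by rw [form_baseVector]; norm_num

theorem mem_hyperbolicSpace_iff (x : Space) :
    x ∈ hyperbolicSpace form baseVector ↔ form x x = 1 ∧ 0 < x.2 0 := by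
  refine and_congr_right fun h => ?_
  have hx : 0 < form x x := by rw [h]; norm_num
  rw [positiveCone, Set.mem_ofPred_eq, form_pos_iff hx baseVector_pos]
  simp [hx, baseVector]

theorem mem_autPlus_of_form_pos {g : Space ≃ₗ[ℝ] Space} (hg : g ∈ aut form lattice)
    (h : ∀ x, 0 < form x x → 0 < form (g x) x) : g ∈ autPlus form lattice := by
  refine ⟨hg, fun w hw x => ?_⟩
  simp only [positiveCone, Set.mem_ofPred_eq, hg.1]
  refine and_congr_right fun hx => ?_
  have hgx : 0 < form (g x) (g x) := by rwa [hg.1]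
  have h' := (form_pos_iff hgx hx).1 (h x hx)
  rw [form_pos_iff hx hw, form_pos_iff hgx hw]
  rcases pos_and_pos_or_neg_and_neg_of_mul_pos h' with ⟨h1, h2⟩ | ⟨h1, h2⟩
  · rw [mul_pos_iff_of_pos_left h1, mul_pos_iff_of_pos_left h2]
  · simp [mul_pos_iff, h1, h2, h1.not_gt, h2.not_gt]

theorem IsRoot.reflection_mem_autPlus {a : Space} (ha : IsRoot form lattice a) :
    reflection form a ha.neg.ne ∈ autPlus form lattice := by
  refine mem_autPlus_of_form_pos ha.reflection_mem fun x hx => ?_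
  rw [reflection_apply, map_sub, map_smul, LinearMap.sub_apply, LinearMap.smul_apply, smul_eq_mul]
  have : 2 / form a a * form a x * form a x ≤ 0 := by
    rw [mul_assoc]
    exact mul_nonpos_of_nonpos_of_nonneg (div_nonpos_of_nonneg_of_nonpos zero_le_two ha.neg.le)
      (mul_self_nonneg _)
  linarith

theorem reflectionGroup_le_autPlus : reflectionGroup form lattice ≤ autPlus form lattice := by
  rw [reflectionGroup, Subgroup.closure_le]
  rintro _ ⟨a, ha, rfl⟩
  exact ha.reflection_mem_autPlus

/-! ### The dominant chamber and its simple roots -/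

theorem form_alpha_rho (i : Fin 7) : form (alpha i) rho = form (alpha i) (alpha i) / 2 := by
  fin_cases i <;> simp [form_apply, alpha, rho] <;> norm_num

theorem form_alpha_self_neg (i : Fin 7) : form (alpha i) (alpha i) < 0 := (isRoot_alpha i).neg

theorem form_rho : form rho rho = 56 := by
  simp [form_apply, rho]; norm_num

theorem form_alpha_alpha_nonneg {i j : Fin 7} (h : i ≠ j) : 0 ≤ form (alpha i) (alpha j) := by
  fin_cases i <;> fin_cases j <;> simp [form_apply, alpha] at h ⊢ <;> norm_num

/-- The part of hyperbolic space on which all `αᵢ` are positive. -/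
def dominantChamber : Set Space :=
  {x | x ∈ hyperbolicSpace form baseVector ∧ ∀ i, 0 < form (alpha i) x}

theorem form_sum_alpha (n : Fin 7 → ℤ) (x : Space) :
    form (∑ i, n i • alpha i) x = ∑ i, n i * form (alpha i) x := by
  simp [map_sum, LinearMap.sum_apply, ← Int.cast_smul_eq_zsmul ℝ]

theorem sum_alpha_pos {n : Fin 7 → ℤ} (hn : ∀ i, 0 ≤ n i) {j : Fin 7} (hj : n j ≠ 0) {x : Space}
    (hx : ∀ i, 0 ≤ form (alpha i) x) (hxj : 0 < form (alpha j) x) :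
    0 < form (∑ i, n i • alpha i) x := by
  rw [form_sum_alpha]
  have h1 : ∀ i, (0 : ℝ) ≤ n i := fun i => by exact_mod_cast hn i
  have h2 : (0 : ℝ) < n j := by exact_mod_cast (hn j).lt_of_ne' hj
  exact Finset.sum_pos' (fun i _ => mul_nonneg (h1 i) (hx i)) ⟨j, Finset.mem_univ j, mul_pos h2 hxj⟩

theorem IsRoot.coeff_ne_zero {b : Space} (hb : IsRoot form lattice b) {n : Fin 7 → ℤ}
    (h : b = ∑ i, n i • alpha i ∨ b = -∑ i, n i • alpha i) : ∃ j, n j ≠ 0 := by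
  by_contra! h0
  have := hb.neg
  rcases h with rfl | rfl <;> simp [h0] at this

/-- A root that is not up to sign one of the `αᵢ` involves another `αⱼ`. -/
theorem IsRoot.exists_coeff_ne_zero {b : Space} (hb : IsRoot form lattice b) {n : Fin 7 → ℤ}
    (h : b = ∑ i, n i • alpha i ∨ b = -∑ i, n i • alpha i) {i : Fin 7} (h1 : b ≠ alpha i)
    (h2 : b ≠ -alpha i) : ∃ j, j ≠ i ∧ n j ≠ 0 := by
  by_contra! h0
  rw [Finset.sum_eq_single i (fun j _ hj => by rw [h0 j hj, zero_smul]) (by simp)] at h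
  obtain ⟨m, rfl⟩ : ∃ m : ℤ, b = m • alpha i := by
    rcases h with h | h
    · exact ⟨_, h⟩
    · exact ⟨-n i, by rw [h, neg_smul]⟩
  rcases Int.isUnit_iff.1 (hb.primitive m _ (alpha_mem i) rfl) with rfl | rfl
  · exact h1 (one_smul _ _)
  · exact h2 (by rw [neg_smul, one_smul])

/-- No root changes sign on the cone on which all `αᵢ` are positive. -/
theorem IsRoot.mul_pos_of_dominant {b : Space} (hb : IsRoot form lattice b) {x y : Space}
    (hx : ∀ i, 0 < form (alpha i) x) (hy : ∀ i, 0 < form (alpha i) y) :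
    0 < form b x * form b y := by
  obtain ⟨n, hn, h⟩ := hb.exists_sum
  obtain ⟨j, hj⟩ := hb.coeff_ne_zero h
  have h1 := sum_alpha_pos hn hj (fun i => (hx i).le) (hx j)
  have h2 := sum_alpha_pos hn hj (fun i => (hy i).le) (hy j)
  rcases h with rfl | rfl
  · exact mul_pos h1 h2
  · simpa using mul_pos h1 h2

theorem exists_scale {x : Space} (hx : 0 < form x x) (hx' : 0 < x.2 0) :
    ∃ c : ℝ, 0 < c ∧ c • x ∈ hyperbolicSpace form baseVector := by
  refine ⟨(√(form x x))⁻¹, by positivity, (mem_hyperbolicSpace_iff _).2 ⟨?_, ?_⟩⟩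
  · simp only [map_smul, LinearMap.smul_apply, smul_eq_mul]
    rw [← mul_assoc, ← mul_inv, Real.mul_self_sqrt hx.le, inv_mul_cancel₀ hx.ne']
  · have : 0 < √(form x x) := by positivity
    simp only [Prod.smul_snd, Pi.smul_apply, smul_eq_mul]
    positivity

/-- The witness is -ρ rescaled: ρ itself lies in the opposite cone, and (αᵢ, -ρ) = -αᵢ²/2 > 0. -/
theorem dominantChamber_nonempty : dominantChamber.Nonempty := by
  obtain ⟨c, hc, h⟩ := exists_scale (x := -rho) (by simp [form_rho]) (by simp [rho])
  refine ⟨_, h, fun i => ?_⟩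
  have := form_alpha_self_neg i
  rw [map_smul, map_neg, form_alpha_rho, smul_eq_mul]
  exact mul_pos hc (by linarith)

theorem isWeylChamber_dominantChamber : IsWeylChamber form lattice baseVector dominantChamber := by
  obtain ⟨x, hx, hx'⟩ := dominantChamber_nonempty
  refine ⟨x, hx, fun b hb h => ?_, ?_⟩
  · have := hb.mul_pos_of_dominant hx' hx'
    rw [h, zero_mul] at this
    exact this.false
  · ext y
    refine and_congr_right fun _ => ⟨fun hy b hb => hb.mul_pos_of_dominant hx' hy, fun h i => ?_⟩
    exact pos_of_mul_pos_right (h _ (isRoot_alpha i)) (hx' i).le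

theorem exists_sum_of_isRoot_of_pos {b : Space} (hb : IsRoot form lattice b)
    (h : ∀ x ∈ dominantChamber, 0 < form b x) :
    ∃ n : Fin 7 → ℤ, (∀ i, 0 ≤ n i) ∧ b = ∑ i, n i • alpha i := by
  obtain ⟨n, hn, e⟩ := hb.exists_sum
  refine ⟨n, hn, e.resolve_right fun e' => ?_⟩
  obtain ⟨j, hj⟩ := hb.coeff_ne_zero e
  obtain ⟨x, hx⟩ := dominantChamber_nonempty
  have h1 := sum_alpha_pos hn hj (fun i => (hx.2 i).le) (hx.2 j)
  have h2 := h x hx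
  rw [e', map_neg, LinearMap.neg_apply] at h2
  linarith

theorem isSimpleRoot_alpha (i : Fin 7) :
    IsSimpleRoot form lattice baseVector dominantChamber (alpha i) := by
  refine ⟨isRoot_alpha i, fun x hx => hx.2 i, ?_⟩
  have hneg := form_alpha_self_neg i
  -- The midpoint of -ρ and its mirror image -ρ + αᵢ. It is orthogonal to αᵢ and positive on the
  -- other αⱼ, since (αⱼ, αᵢ) ≥ 0.
  set z : Space := -rho + (1 / 2 : ℝ) • alpha i with hz
  have hzj : ∀ j, form (alpha j) z = -(form (alpha j) (alpha j) / 2) +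
      1 / 2 * form (alpha j) (alpha i) := fun j => by
    rw [hz, map_add, map_neg, map_smul, form_alpha_rho, smul_eq_mul]
  have hzi : form (alpha i) z = 0 := by rw [hzj]; ring
  have hzpos : ∀ j, j ≠ i → 0 < form (alpha j) z := fun j hj => by
    rw [hzj]
    have h1 := form_alpha_self_neg j
    have h2 := form_alpha_alpha_nonneg hj
    linarith
  have hzz : 0 < form z z := by
    have e : form z z = 56 - form (alpha i) (alpha i) / 4 := by
      rw [hz]
      simp only [map_add, map_neg, map_smul, LinearMap.add_apply, LinearMap.neg_apply,
        LinearMap.smul_apply, smul_eq_mul, form_rho, form_comm rho (alpha i), form_alpha_rho]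
      ring
    linarith
  have hz0 : 0 < z.2 0 := by
    rw [hz]
    fin_cases i <;> norm_num [rho, alpha]
  obtain ⟨c, hc, h⟩ := exists_scale hzz hz0
  refine ⟨c • z, h, by rw [map_smul, hzi, smul_zero], fun b hb h1 h2 x hx => ?_⟩
  rw [map_smul, smul_eq_mul, mul_left_comm]
  refine mul_pos hc ?_
  obtain ⟨n, hn, e⟩ := hb.exists_sum
  obtain ⟨j, hji, hj⟩ := hb.exists_coeff_ne_zero e h1 h2
  have k1 := sum_alpha_pos hn hj (fun i => (hx.2 i).le) (hx.2 j)
  have k2 := sum_alpha_pos (x := z) hn hj (fun k => by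
    by_cases hk : k = i
    · rw [hk, hzi]
    · exact (hzpos k hk).le) (hzpos j hji)
  rcases e with rfl | rfl
  · exact mul_pos k1 k2
  · simpa using mul_pos k1 k2

theorem setOf_isSimpleRoot_dominantChamber :
    {a | IsSimpleRoot form lattice baseVector dominantChamber a} = Set.range alpha := by
  ext a
  refine ⟨?_, ?_⟩
  swap
  · rintro ⟨i, rfl⟩
    exact isSimpleRoot_alpha i
  rintro ⟨ha, hpos, y, hy, hay, h⟩
  by_contra hne
  obtain ⟨n, hn, e⟩ := exists_sum_of_isRoot_of_pos ha hpos
  obtain ⟨j, hj⟩ := ha.coeff_ne_zero (Or.inl e)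
  obtain ⟨x, hx⟩ := dominantChamber_nonempty
  -- If a were none of the αᵢ, its face point y would be on the positive side of all of them, so a,
  -- a nonnegative sum of them, could not vanish at y.
  have hy' : ∀ i, 0 < form (alpha i) y := fun i => by
    refine pos_of_mul_pos_right (h _ (isRoot_alpha i) (fun hi => hne ⟨i, hi⟩) (fun hi => ?_) x hx)
      (hx.2 i).le
    have h1 := hx.2 i
    have h2 := hpos x hx
    rw [hi, map_neg, LinearMap.neg_apply] at h1
    linarith
  have := sum_alpha_pos hn hj (fun i => (hy' i).le) (hy' j)
  rw [← e, hay] at this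
  exact this.false

/-! ### The Weyl vector -/

theorem eq_zero_of_form_alpha_eq_zero {x : Space} (h : ∀ i, form (alpha i) x = 0) : x = 0 := by
  have h0 := h 0
  have h1 := h 1
  have h2 := h 2
  have h3 := h 3
  have h4 := h 4
  have h5 := h 5
  simp [form_apply, alpha] at h0 h1 h2 h3 h4 h5
  refine Prod.ext (funext fun i => ?_) (funext fun i => ?_) <;> fin_cases i <;> simp <;> linarith

theorem isWeylVector_iff (v : Space) :
    IsWeylVector form lattice baseVector dominantChamber v ↔ v = rho := by
  have key : ∀ a, IsSimpleRoot form lattice baseVector dominantChamber a ↔ ∃ i, alpha i = a :=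
    fun a => Set.ext_iff.1 setOf_isSimpleRoot_dominantChamber a
  refine ⟨fun h => sub_eq_zero.1 (eq_zero_of_form_alpha_eq_zero fun i => ?_), ?_⟩
  · rw [map_sub, form_comm _ v, h _ (isSimpleRoot_alpha i), form_alpha_rho, sub_self]
  · rintro rfl a ha
    obtain ⟨i, rfl⟩ := (key a).1 ha
    rw [form_comm, form_alpha_rho]

theorem form_rho_vec (a b c d p q : ℤ) :
    form rho (vec a b c d p q) = -((a + 3 * b + c + 3 * d + 6 * p + q : ℤ) : ℝ) := by
  simp [form_apply, rho, vec]; ring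

/-- The height -(ρ, x) counts the coefficients of x with weight 1 for short and 3 for long simple
roots, and the hypothesis says that it equals N. Height 1 leaves one short simple root; height 3
leaves a long one or three short ones. -/
theorem vec_mem_range_alpha {a b c d p q : ℤ} (h : IsRootCoord a b c d p q)
    (ht : a + 3 * b + c + 3 * d + 6 * p + q =
      a ^ 2 - 3 * a * b + 3 * b ^ 2 + (c ^ 2 - 3 * c * d + 3 * d ^ 2) + q * (q - p)) :
    vec a b c d p q ∈ Set.range alpha := by
  have hpos : 0 < a + 3 * b + c + 3 * d + 6 * p + q := by
    rcases h with h | h <;> omega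
  have hmem : ∀ i : Fin 7, a = ![1, 0, 0, 0, 0, 0, -2] i → b = ![0, 1, 0, 0, 0, 0, -1] i →
      c = ![0, 0, 1, 0, 0, -2, 0] i → d = ![0, 0, 0, 1, 0, -1, 0] i →
      p = ![0, 0, 0, 0, 0, 1, 1] i → q = ![0, 0, 0, 0, 1, 0, 0] i →
      vec a b c d p q ∈ Set.range alpha := by
    rintro i rfl rfl rfl rfl rfl rfl
    exact ⟨i, alpha_eq_vec i⟩
  rcases h.nonneg_or with ⟨hq, m, h0, h1, h2, h3, h4, h5⟩ | ⟨hq, m, h0, h1, h2, h3, h4, h5⟩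
  swap
  · omega
  rcases h with h | ⟨h, k1, k2, k3, k4⟩
  · rw [h] at ht
    rcases (by omega : a + 2 * m = 1 ∨ c + 2 * (p - m) = 1 ∨ q = 1 ∨ p - m = 1 ∨ m = 1)
      with e | e | e | e | e
    · apply hmem 0 <;> simp <;> omega
    · apply hmem 2 <;> simp <;> omega
    · apply hmem 4 <;> simp <;> omega
    · apply hmem 5 <;> simp <;> omega
    · apply hmem 6 <;> simp <;> omega
  · rw [h] at ht
    rcases (by omega : b + m = 1 ∨ d + (p - m) = 1 ∨ (b + m = 0 ∧ d + (p - m) = 0)) with e | e | e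
    · apply hmem 1 <;> simp <;> omega
    · apply hmem 3 <;> simp <;> omega
    · exfalso
      -- Divisibility by 3 leaves only 3α₁, 3α₃, 3α₅, 3α₇ and 3α₆, for which N is 9 and not 3.
      have : (a = 3 ∧ b = 0 ∧ c = 0 ∧ d = 0 ∧ p = 0 ∧ q = 0) ∨
          (a = 0 ∧ b = 0 ∧ c = 3 ∧ d = 0 ∧ p = 0 ∧ q = 0) ∨
          (a = 0 ∧ b = 0 ∧ c = 0 ∧ d = 0 ∧ p = 0 ∧ q = 3) ∨
          (a = -6 ∧ b = -3 ∧ c = 0 ∧ d = 0 ∧ p = 3 ∧ q = 0) ∨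
          (a = 0 ∧ b = 0 ∧ c = -6 ∧ d = -3 ∧ p = 3 ∧ q = 0) := by
        have hm : m ≤ 3 := by omega
        rcases (by omega : p = 0 ∨ p = 3) with rfl | rfl <;> interval_cases m <;> omega
      rcases this with ⟨rfl, rfl, rfl, rfl, rfl, rfl⟩ | ⟨rfl, rfl, rfl, rfl, rfl, rfl⟩ |
        ⟨rfl, rfl, rfl, rfl, rfl, rfl⟩ | ⟨rfl, rfl, rfl, rfl, rfl, rfl⟩ |
        ⟨rfl, rfl, rfl, rfl, rfl, rfl⟩ <;> norm_num at h

theorem setOf_form_rho_eq_range_alpha :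
    {a | IsRoot form lattice a ∧ form rho a = form a a / 2} = Set.range alpha := by
  ext x
  constructor
  · rintro ⟨hx, h⟩
    obtain ⟨a, b, c, d, p, q, rfl, hc⟩ := hx.exists_coord
    refine vec_mem_range_alpha hc ?_
    rw [form_rho_vec, form_vec_self, neg_mul, neg_div, neg_inj,
      mul_div_cancel_left₀ _ two_ne_zero] at h
    exact_mod_cast h
  · rintro ⟨i, rfl⟩
    exact ⟨isRoot_alpha i, by rw [form_comm, form_alpha_rho]⟩

/-! ### Transitivity of the reflection group on the chambers -/

/-- In `cone_identity` all terms on the right are nonnegative, so with P = u.2 0 it gives P² ≤ 2MCP,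
hence P ≤ 2MC, and then bounds on `u.1`. The norm equation with P ≥ 1 bounds the last coordinate. -/
theorem exists_bound {x : Space} (hx : x ∈ hyperbolicSpace form baseVector) (C : ℝ) :
    ∃ K : ℝ, ∀ u : Space, form u u = 56 → 1 ≤ u.2 0 → form x u ≤ C →
      (∀ i, |u.1 i| ≤ K) ∧ ∀ i, |u.2 i| ≤ K := by
  obtain ⟨hx1, hM⟩ := (mem_hyperbolicSpace_iff x).1 hx
  set M := x.2 0
  set X := ∑ i, |x.1 i| with hX
  set K := 2 * C * (1 + X) with hK
  refine ⟨2 * M * C + K + 28 + 4 * K ^ 2, fun u hu hP hC => ?_⟩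
  have hid := cone_identity x u
  rw [hx1, hu] at hid
  have hux : form u u = _ := form_apply u u
  rw [hu] at hux
  change 2 * M * u.2 0 * form x u = _ at hid
  rw [show x.2 0 = M from rfl] at hid
  set P := u.2 0 with hPdef
  have hXi : ∀ i, |x.1 i| ≤ X := fun i =>
    Finset.single_le_sum (f := fun i => |x.1 i|) (fun j _ => abs_nonneg _) (Finset.mem_univ i)
  have hX0 : 0 ≤ X := (abs_nonneg _).trans (hXi 0)
  have hle : 2 * M * P * form x u ≤ P * (2 * M * C) := by
    have := mul_le_mul_of_nonneg_left hC (mul_pos hM (zero_lt_one.trans_le hP)).le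
    linarith
  have hsum : P ^ 2 + ((P * x.1 0 - M * u.1 0) ^ 2 + (P * x.1 1 - M * u.1 1) ^ 2 +
      3 * (P * x.1 2 - M * u.1 2) ^ 2 + 3 * (P * x.1 3 - M * u.1 3) ^ 2) ≤ P * (2 * M * C) := by
    linarith [sq_nonneg M]
  have hsq0 := sq_nonneg (P * x.1 0 - M * u.1 0)
  have hsq1 := sq_nonneg (P * x.1 1 - M * u.1 1)
  have hsq2 := sq_nonneg (P * x.1 2 - M * u.1 2)
  have hsq3 := sq_nonneg (P * x.1 3 - M * u.1 3)
  have hPle : P ≤ 2 * M * C := by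
    refine le_of_mul_le_mul_left (a := P) ?_ (zero_lt_one.trans_le hP)
    linarith [sq P]
  have hMC : 0 ≤ 2 * M * C := by linarith
  have hsq : ∀ i, (P * x.1 i - M * u.1 i) ^ 2 ≤ (2 * M * C) ^ 2 := by
    have h1 : P * (2 * M * C) ≤ (2 * M * C) ^ 2 := by
      rw [sq]
      exact mul_le_mul_of_nonneg_right hPle hMC
    have h2 := sq_nonneg P
    intro i
    fin_cases i <;> simp only [Fin.zero_eta, Fin.mk_one, Fin.reduceFinMk] <;> linarith
  have hui : ∀ i, |u.1 i| ≤ K := fun i => by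
    have h1 := abs_le_of_sq_le_sq (hsq i) hMC
    have h2 : M * |u.1 i| ≤ M * K := by
      calc M * |u.1 i| = |P * x.1 i - (P * x.1 i - M * u.1 i)| := by
            rw [sub_sub_cancel, abs_mul, abs_of_pos hM]
        _ ≤ |P * x.1 i| + |P * x.1 i - M * u.1 i| := abs_sub _ _
        _ ≤ 2 * M * C * X + 2 * M * C := by
            refine add_le_add ?_ h1
            rw [abs_mul, abs_of_pos (zero_lt_one.trans_le hP)]
            exact mul_le_mul hPle (hXi i) (abs_nonneg _) hMC
        _ = M * K := by rw [hK]; ring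
    exact le_of_mul_le_mul_left h2 hM
  have hK0 : 0 ≤ K := (abs_nonneg _).trans (hui 0)
  have hKsq := sq_nonneg K
  refine ⟨fun i => (hui i).trans (by linarith), Fin.forall_fin_two.2 ⟨?_, ?_⟩⟩
  · rw [abs_of_pos (zero_lt_one.trans_le hP)]
    linarith
  · clear_value K
    have hs : ∀ i, u.1 i ^ 2 ≤ K ^ 2 := fun i => sq_le_sq' (abs_le.1 (hui i)).1 (abs_le.1 (hui i)).2
    have hs0 := hs 0
    have hs1 := hs 1
    have hs2 := hs 2
    have hs3 := hs 3
    have e : 2 * P * u.2 1 = -(56 + (u.1 0 ^ 2 + u.1 1 ^ 2 + 3 * u.1 2 ^ 2 + 3 * u.1 3 ^ 2)) := by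
      linarith
    have hneg : u.2 1 ≤ 0 := by
      by_contra! hpos
      have := mul_pos (zero_lt_one.trans_le hP) hpos
      linarith [sq_nonneg (u.1 0), sq_nonneg (u.1 1), sq_nonneg (u.1 2), sq_nonneg (u.1 3)]
    have hPn : -(u.2 1) ≤ P * -(u.2 1) := le_mul_of_one_le_left (by linarith) hP
    rw [abs_of_nonpos hneg]
    linarith

theorem finite_setOf_form_le {x : Space} (hx : x ∈ hyperbolicSpace form baseVector) (C : ℝ) :
    {u | u ∈ lattice ∧ form u u = 56 ∧ 0 < u.2 0 ∧ form x u ≤ C}.Finite := by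
  obtain ⟨K, hK⟩ := exists_bound hx C
  set N : ℤ := ⌈4 * K⌉ with hN
  refine ((Set.finite_Icc (fun _ : Fin 6 => -N) (fun _ => N)).image
    fun k => vec (k 0) (k 1) (k 2) (k 3) (k 4) (k 5)).subset ?_
  rintro u ⟨hu, hu1, hu2, hu3⟩
  obtain ⟨a, b, c, d, p, q, rfl⟩ := (mem_lattice_iff u).1 hu
  obtain ⟨h1, h2⟩ := hK _ hu1 (by
    have : (0 : ℝ) < q := by simpa [vec] using hu2
    have : 1 ≤ q := by exact_mod_cast this
    simpa [vec] using (by exact_mod_cast this : (1 : ℝ) ≤ q)) hu3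
  have h10 := abs_le.1 (h1 0)
  have h11 := abs_le.1 (h1 1)
  have h12 := abs_le.1 (h1 2)
  have h13 := abs_le.1 (h1 3)
  have h20 := abs_le.1 (h2 0)
  have h21 := abs_le.1 (h2 1)
  simp [vec] at h10 h11 h12 h13 h20 h21
  have key : ∀ z : ℤ, -(4 * K) ≤ z → (z : ℝ) ≤ 4 * K → -N ≤ z ∧ z ≤ N := by
    intro z hz1 hz2
    have hc := Int.le_ceil (4 * K)
    rw [← hN] at hc
    constructor
    · have : ((-N : ℤ) : ℝ) ≤ z := by push_cast; linarith
      exact_mod_cast this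
    · exact_mod_cast hz2.trans hc
  have ka := key a (by linarith) (by linarith)
  have kb := key b (by linarith) (by linarith)
  have kc := key c (by linarith) (by linarith)
  have kd := key d (by linarith) (by linarith)
  have kp := key p (by linarith) (by linarith)
  have kq := key q (by linarith) (by linarith)
  refine ⟨![a, b, c, d, p, q], ⟨fun i => ?_, fun i => ?_⟩, rfl⟩
  · fin_cases i <;> simp <;> omega
  · fin_cases i <;> simp <;> omega

theorem rho_mem : rho ∈ lattice :=
  (mem_lattice_iff _).2 ⟨5, 3, 5, 3, -13, -6, by
    refine Prod.ext (funext fun i => ?_) (funext fun i => ?_) <;> fin_cases i <;>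
      norm_num [rho, vec]⟩

theorem pos_of_mem_autPlus {g : Space ≃ₗ[ℝ] Space} (hg : g ∈ autPlus form lattice) {x : Space}
    (hx : 0 < form x x) (hx' : 0 < x.2 0) : 0 < (g x).2 0 := by
  have h := hg.2 x hx x
  simp only [positiveCone, Set.mem_ofPred_eq, hg.1.1, hx, true_and, iff_true] at h
  rw [form_pos_iff (by rwa [hg.1.1]) hx] at h
  exact pos_of_mul_pos_left h hx'.le

/-- Every point of hyperbolic space can be moved into the closure of the dominant chamber by the
reflection group. -/
theorem exists_mem_reflectionGroup_nonneg {x : Space}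
    (hx : x ∈ hyperbolicSpace form baseVector) :
    ∃ g ∈ reflectionGroup form lattice, ∀ i, 0 ≤ form (g (alpha i)) x := by
  set S := {u | (∃ g ∈ reflectionGroup form lattice, u = g (-rho)) ∧ form x u ≤ form x (-rho)}
    with hS
  have hfin : S.Finite := by
    refine (finite_setOf_form_le hx (form x (-rho))).subset ?_
    rintro _ ⟨⟨g, hg, rfl⟩, hle⟩
    have hg' := reflectionGroup_le_autPlus hg
    have hr : form (-rho) (-rho) = 56 := by simp [form_rho]
    exact ⟨(hg'.1.2 _).2 (neg_mem rho_mem), by rw [hg'.1.1, hr],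
      pos_of_mem_autPlus hg' (by rw [hr]; norm_num) (by simp [rho]), hle⟩
  obtain ⟨_, ⟨⟨g, hg, rfl⟩, hle⟩, hmin⟩ := Set.exists_min_image S (form x) hfin
    ⟨-rho, ⟨1, one_mem _, rfl⟩, le_rfl⟩
  refine ⟨g, hg, fun i => ?_⟩
  have hneg := form_alpha_self_neg i
  have hs : reflection form (alpha i) hneg.ne (-rho) = -rho + alpha i := by
    rw [reflection_apply, map_neg, form_alpha_rho]
    have : (2 / form (alpha i) (alpha i) * -(form (alpha i) (alpha i) / 2)) = -1 := by
      have := hneg.ne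
      field_simp
    rw [this, neg_smul, one_smul, sub_neg_eq_add]
  have hgs : g * reflection form (alpha i) hneg.ne ∈ reflectionGroup form lattice :=
    mul_mem hg (Subgroup.subset_closure ⟨_, isRoot_alpha i, rfl⟩)
  -- The next image of -ρ either belongs to `S`, where g(-ρ) is minimal, or exceeds the bound
  -- defining `S`. As it equals g(-ρ) + g(αᵢ), the inequality says (x, g(αᵢ)) ≥ 0.
  have hm : form x (g (-rho)) ≤ form x (g (-rho + alpha i)) := by
    by_cases h : form x (g (-rho + alpha i)) ≤ form x (-rho)
    · exact hmin _ ⟨⟨_, hgs, by rw [LinearEquiv.mul_apply, hs]⟩, h⟩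
    · exact hle.trans (not_le.1 h).le
  rw [map_add, map_add] at hm
  rw [form_comm]
  linarith

theorem IsWeylChamber.exists_eq_image {D : Set Space}
    (hD : IsWeylChamber form lattice baseVector D) :
    ∃ g ∈ reflectionGroup form lattice, D = g '' dominantChamber := by
  obtain ⟨x, hx, hx', e⟩ := id hD
  have hxD : x ∈ D := by
    rw [e]
    exact ⟨hx, fun b hb => mul_self_pos.2 (hx' b hb)⟩
  obtain ⟨g, hg, h⟩ := exists_mem_reflectionGroup_nonneg hx
  have hg' := reflectionGroup_le_autPlus hg
  refine ⟨g, hg, ?_⟩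
  have hxg : x ∈ g '' dominantChamber := by
    rw [mem_image_iff]
    refine ⟨(mem_hyperbolicSpace_iff_of_mem_autPlus baseVector_pos (inv_mem hg') x).2 hx,
      fun i => ?_⟩
    rw [form_comm, aut_apply_inv hg'.1, form_comm]
    exact (h i).lt_of_ne' (hx' _ ((isRoot_alpha i).map hg'.1))
  rw [hD.eq_of_mem hxD, (isWeylChamber_dominantChamber.image baseVector_pos hg').eq_of_mem hxg]

/-! ### The automorphisms of the dominant chamber -/

theorem eq_of_forall_alpha {g h : Space ≃ₗ[ℝ] Space} (hg : g ∈ aut form lattice)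
    (hh : h ∈ aut form lattice) (e : ∀ i, g (alpha i) = h (alpha i)) : g = h := by
  have key : ∀ x, g⁻¹ x = h⁻¹ x := fun x => by
    refine sub_eq_zero.1 (eq_zero_of_form_alpha_eq_zero fun i => ?_)
    rw [map_sub, form_comm, aut_apply_inv hg, form_comm _ (h⁻¹ x), aut_apply_inv hh, e, sub_self]
  rw [← inv_inj]
  exact LinearEquiv.ext key

/-- The Gram matrix of the simple roots. -/
def gram : Fin 7 → Fin 7 → ℤ :=
  ![![-2, 3, 0, 0, 0, 0, 1], ![3, -6, 0, 0, 0, 0, 0], ![0, 0, -2, 3, 0, 1, 0],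
    ![0, 0, 3, -6, 0, 0, 0], ![0, 0, 0, 0, -2, 1, 1], ![0, 0, 1, 0, 1, -2, 0],
    ![1, 0, 0, 0, 1, 0, -2]]

theorem form_alpha_alpha (i j : Fin 7) : form (alpha i) (alpha j) = gram i j := by
  rw [alpha_eq_vec, alpha_eq_vec j, form_vec_vec]
  congr 1
  revert i j
  decide

/-- The diagram automorphism. -/
noncomputable def flip : Space ≃ₗ[ℝ] Space :=
  LinearEquiv.ofInvolutive
    { toFun := fun x => (![x.1 0, -x.1 1, x.1 2, -x.1 3], x.2)
      map_add' := fun x y => Prod.ext (funext fun i => by fin_cases i <;> simp <;> ring) rfl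
      map_smul' := fun c x => Prod.ext (funext fun i => by fin_cases i <;> simp) rfl }
    fun x => Prod.ext (funext fun i => by fin_cases i <;> simp) rfl

theorem flip_apply (x : Space) : flip x = (![x.1 0, -x.1 1, x.1 2, -x.1 3], x.2) := rfl

theorem flip_mul_flip : flip * flip = 1 :=
  LinearEquiv.ext fun x => flip.symm_apply_apply x

theorem flip_vec (a b c d p q : ℤ) : flip (vec a b c d p q) = vec c d a b p q := by
  rw [flip_apply]
  refine Prod.ext (funext fun i => ?_) rfl
  fin_cases i <;> simp [vec] <;> ring

theorem flip_mem_aut : flip ∈ aut form lattice := by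
  have key : ∀ x ∈ lattice, flip x ∈ lattice := by
    intro x hx
    obtain ⟨a, b, c, d, p, q, rfl⟩ := (mem_lattice_iff x).1 hx
    exact (mem_lattice_iff _).2 ⟨_, _, _, _, _, _, flip_vec ..⟩
  refine ⟨fun x y => by simp [form_apply, flip_apply], fun x => ⟨fun h => ?_, key x⟩⟩
  have := key _ h
  rwa [← LinearEquiv.mul_apply, flip_mul_flip] at this

theorem flip_mem_autPlus : flip ∈ autPlus form lattice := by
  refine mem_autPlus_of_form_pos flip_mem_aut fun x hx => ?_
  rw [form_pos_iff (by rwa [flip_mem_aut.1]) hx]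
  exact mul_self_pos.2 (ne_zero_of_form_pos (x := x) hx)

theorem flip_alpha (i : Fin 7) : flip (alpha i) = alpha (![2, 3, 0, 1, 4, 6, 5] i) := by
  rw [alpha_eq_vec, flip_vec, alpha_eq_vec]
  congr 1 <;> revert i <;> decide

/-- Starting from the fixed end α₂ and walking along the chain, each node is determined by its norm
and its inner products with the one or two nodes before it. -/
theorem eq_one_of_permutes {g : Space ≃ₗ[ℝ] Space} (hg : g ∈ aut form lattice)
    (h : ∀ i, ∃ j, alpha j = g (alpha i)) (h1 : g (alpha 1) = alpha 1) : g = 1 := by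
  have step : ∀ i : Fin 7, ∀ s : Finset (Fin 7), (∀ k ∈ s, g (alpha k) = alpha k) →
      (∀ j, (∀ k ∈ s, gram j k = gram i k) ∧ gram j j = gram i i → j = i) →
      g (alpha i) = alpha i := by
    intro i s hs hi
    obtain ⟨j, hj⟩ := h i
    have e : ∀ k ∈ s, gram j k = gram i k := fun k hk => by
      have := hg.1 (alpha i) (alpha k)
      rw [← hj, hs k hk, form_alpha_alpha, form_alpha_alpha] at this
      exact_mod_cast this
    have e' : gram j j = gram i i := by
      have := hg.1 (alpha i) (alpha i)
      rw [← hj, form_alpha_alpha, form_alpha_alpha] at this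
      exact_mod_cast this
    rw [← hj, hi j ⟨e, e'⟩]
  have h0 := step 0 {1} (by simpa using h1) (by decide)
  have h6 := step 6 {0, 1} (by simpa using ⟨h0, h1⟩) (by decide)
  have h4 := step 4 {6, 0} (by simpa using ⟨h6, h0⟩) (by decide)
  have h5 := step 5 {4, 6} (by simpa using ⟨h4, h6⟩) (by decide)
  have h2 := step 2 {5, 4} (by simpa using ⟨h5, h4⟩) (by decide)
  have h3 := step 3 {2, 5} (by simpa using ⟨h2, h5⟩) (by decide)
  refine eq_of_forall_alpha hg (one_mem _) fun i => ?_
  fin_cases i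
  exacts [h0, h1, h2, h3, h4, h5, h6]

theorem eq_one_or_eq_flip {g : Space ≃ₗ[ℝ] Space} (hg : g ∈ autPlus form lattice)
    (hD : g '' dominantChamber = dominantChamber) : g = 1 ∨ g = flip := by
  have h : ∀ i, ∃ j, alpha j = g (alpha i) := fun i => by
    have := (isSimpleRoot_alpha i).image baseVector_pos hg
    rw [hD] at this
    exact setOf_isSimpleRoot_dominantChamber.subset this
  obtain ⟨j, hj⟩ := h 1
  have e : gram j j = gram 1 1 := by
    have := hg.1.1 (alpha 1) (alpha 1)
    rw [← hj, form_alpha_alpha, form_alpha_alpha] at this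
    exact_mod_cast this
  have hj' : j = 1 ∨ j = 3 :=
    (by decide : ∀ j, gram j j = gram 1 1 → j = 1 ∨ j = 3) j e
  rcases hj' with rfl | rfl
  · exact Or.inl (eq_one_of_permutes hg.1 h hj.symm)
  · right
    have : flip * g = 1 := by
      refine eq_one_of_permutes (mul_mem flip_mem_aut hg.1) (fun i => ?_) ?_
      · obtain ⟨k, hk⟩ := h i
        exact ⟨_, by rw [LinearEquiv.mul_apply, ← hk, flip_alpha]⟩
      · rw [LinearEquiv.mul_apply, ← hj, flip_alpha]
        rfl
    rw [← one_mul g, ← flip_mul_flip, mul_assoc, this, mul_one]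

theorem isArithmetic_lattice : IsArithmetic form lattice baseVector := by
  intro D hD
  obtain ⟨w, hw, rfl⟩ := hD.exists_eq_image
  have hw' := reflectionGroup_le_autPlus hw
  have hsub : (chamberAut form lattice (w '' dominantChamber) : Set (Space ≃ₗ[ℝ] Space)) ⊆
      {1, w * flip * w⁻¹} := by
    rintro g ⟨hg, hgD⟩
    have key : (w⁻¹ * g * w : Space ≃ₗ[ℝ] Space) '' dominantChamber = dominantChamber := by
      ext x
      rw [mem_image_iff, mul_inv_rev, mul_inv_rev, inv_inv, LinearEquiv.mul_apply,
        LinearEquiv.mul_apply, ← mem_image_iff, ← hgD, apply_inv_self, mem_image_iff,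
        inv_apply_self]
    rcases eq_one_or_eq_flip (mul_mem (mul_mem (inv_mem hw') hg) hw') key with h | h
    · left
      rw [mul_eq_one_iff_eq_inv, inv_mul_eq_iff_eq_mul, mul_inv_cancel] at h
      exact h
    · right
      rw [Set.mem_singleton_iff, ← h]
      group
  exact ((Set.finite_singleton _).insert _).subset hsub

/-! ### The index of the reflection group -/

/-- Membership in the sublattice `3 L + ℤ α₂`, which the reflection group preserves. -/
def InSublattice (x : Space) : Prop :=
  ∃ a b c d p q : ℤ, x = vec (3 * a) b (3 * c) (3 * d) (3 * p) (3 * q)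

theorem vec_add (a b c d p q a' b' c' d' p' q' : ℤ) :
    vec a b c d p q + vec a' b' c' d' p' q' =
      vec (a + a') (b + b') (c + c') (d + d') (p + p') (q + q') := by
  refine Prod.ext (funext fun i => ?_) (funext fun i => ?_) <;> fin_cases i <;> simp [vec] <;> ring

theorem inSublattice_of_dvd {a b c d p q : ℤ} (ha : 3 ∣ a) (hc : 3 ∣ c) (hd : 3 ∣ d) (hp : 3 ∣ p)
    (hq : 3 ∣ q) : InSublattice (vec a b c d p q) := by
  obtain ⟨a, rfl⟩ := ha
  obtain ⟨c, rfl⟩ := hc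
  obtain ⟨d, rfl⟩ := hd
  obtain ⟨p, rfl⟩ := hp
  obtain ⟨q, rfl⟩ := hq
  exact ⟨_, _, _, _, _, _, rfl⟩

/-- Norm -2 roots have inner products divisible by 3 with the whole sublattice, so they move its
vectors by 3L. A norm -6 root is bα₂ + dα₄ modulo 3L with b² + d² ≡ 1 mod 3, hence congruent to ±α₂
or ±α₄; the two classes are never mixed. -/
theorem IsRoot.inSublattice_reflection {r : Space} (hr : IsRoot form lattice r) {x : Space}
    (hx : InSublattice x) : InSublattice (reflection form r hr.neg.ne x) := by
  obtain ⟨a, b, c, d, p, q, rfl, h⟩ := hr.exists_coord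
  obtain ⟨a', b', c', d', p', q', rfl⟩ := hx
  -- Here n = N and m = (r, x)/N, so the reflection is x ↦ x + mr.
  have happ : ∀ m n : ℤ, 0 < n → form (vec a b c d p q) (vec a b c d p q) = -2 * n →
      form (vec a b c d p q) (vec (3 * a') b' (3 * c') (3 * d') (3 * p') (3 * q')) = (n * m : ℤ) →
      reflection form (vec a b c d p q) hr.neg.ne
        (vec (3 * a') b' (3 * c') (3 * d') (3 * p') (3 * q')) =
      vec (3 * a' + m * a) (b' + m * b) (3 * c' + m * c) (3 * d' + m * d) (3 * p' + m * p)
        (3 * q' + m * q) := by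
    intro m n hn h1 h2
    have hn' : (n : ℝ) ≠ 0 := by exact_mod_cast hn.ne'
    rw [reflection_apply, h1, h2, sub_eq_add_neg, ← neg_smul,
      show -(2 / (-2 * (n : ℝ)) * ((n * m : ℤ) : ℝ)) = (m : ℝ) by push_cast; field_simp,
      Int.cast_smul_eq_zsmul, smul_vec, vec_add]
  have key : ∀ {s t m : ℤ}, 3 ∣ m * t → 3 ∣ 3 * s + m * t := fun h => (dvd_mul_right _ _).add h
  rcases h with h | ⟨h, ⟨a, rfl⟩, ⟨c, rfl⟩, ⟨p, rfl⟩, ⟨q, rfl⟩⟩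
  · rw [happ (3 * (a * (-2 * a' + b') + b * (3 * a' - 2 * b') + c * (-2 * c' + 3 * d') +
      d * (3 * c' - 6 * d') + p * q' + q * (p' - 2 * q'))) 1 one_pos
      (by rw [form_vec_self, h]) (by rw [form_vec_vec]; congr 1; ring)]
    refine inSublattice_of_dvd ?_ ?_ ?_ ?_ ?_ <;>
      exact key (Dvd.dvd.mul_right (dvd_mul_right _ _) _)
  · rw [happ (3 * (a * (-2 * a') + b * a' + c * (-2 * c' + 3 * d') +
      d * (c' - 2 * d') + p * q' + q * (p' - 2 * q')) + 3 * a * b' - 2 * b * b') 3 three_pos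
      (by rw [form_vec_self, h]) (by rw [form_vec_vec]; congr 1; ring)]
    refine inSublattice_of_dvd ?_ ?_ (key ?_) ?_ ?_
    · exact key (Dvd.dvd.mul_left (dvd_mul_right _ _) _)
    · exact key (Dvd.dvd.mul_left (dvd_mul_right _ _) _)
    · have hbd : 3 ∣ b * d := by
        have h' : b * b + d * d = 1 + 3 * (-a ^ 2 + a * b - c ^ 2 + c * d - q * (q - p)) := by
          linarith
        have h'' : (b * b + d * d) % 3 = 1 := by omega
        rw [Int.dvd_iff_emod_eq_zero]
        rcases (by omega : b % 3 = 0 ∨ b % 3 = 1 ∨ b % 3 = 2) with hb | hb | hb <;>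
        rcases (by omega : d % 3 = 0 ∨ d % 3 = 1 ∨ d % 3 = 2) with hd | hd | hd <;>
        simp [Int.add_emod, Int.mul_emod, hb, hd] at h'' ⊢
      obtain ⟨k, hk⟩ := hbd
      exact ⟨(a * (-2 * a') + b * a' + c * (-2 * c' + 3 * d') + d * (c' - 2 * d') + p * q' +
        q * (p' - 2 * q') + a * b') * d - 2 * k * b', by linear_combination (-2 * b') * hk⟩
    · exact key (Dvd.dvd.mul_left (dvd_mul_right _ _) _)
    · exact key (Dvd.dvd.mul_left (dvd_mul_right _ _) _)

theorem inSublattice_iff_of_mem_reflectionGroup {g : Space ≃ₗ[ℝ] Space}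
    (hg : g ∈ reflectionGroup form lattice) : ∀ x, InSublattice (g x) ↔ InSublattice x := by
  induction hg using Subgroup.closure_induction with
  | mem g hg =>
    obtain ⟨a, ha, rfl⟩ := hg
    intro x
    refine ⟨fun h => ?_, ha.inSublattice_reflection⟩
    have := ha.inSublattice_reflection h
    rwa [reflection_involutive] at this
  | one => exact fun _ => Iff.rfl
  | mul g h _ _ hg hh => exact fun x => (hg _).trans (hh x)
  | inv g _ hg => exact fun x => by rw [← hg (g⁻¹ x), apply_inv_self]

theorem flip_notMem_reflectionGroup : flip ∉ reflectionGroup form lattice := by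
  intro h
  have h1 : InSublattice (alpha 1) := ⟨0, 1, 0, 0, 0, 0, alpha_eq_vec 1⟩
  rw [← inSublattice_iff_of_mem_reflectionGroup h, flip_alpha] at h1
  obtain ⟨a, b, c, d, p, q, e⟩ := h1
  have e1 : alpha 3 = vec (3 * a) b (3 * c) (3 * d) (3 * p) (3 * q) := e
  -- The inner product of α₄ with any vector of 3L + ℤα₂ is divisible by 9, whereas α₄² = -6.
  have e2 := form_alpha_alpha 3 3
  nth_rewrite 1 [alpha_eq_vec 3] at e2
  rw [e1, form_vec_vec] at e2
  have e3 := Int.cast_injective e2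
  simp [gram] at e3
  omega

theorem relIndex_reflectionGroup :
    (reflectionGroup form lattice).relIndex (autPlus form lattice) = 2 := by
  rw [Subgroup.relIndex_eq_two_iff]
  refine ⟨flip, flip_mem_autPlus, fun b hb => ?_⟩
  -- By transitivity some w in the reflection group agrees with b on the dominant chamber as a set,
  -- so w⁻¹b is 1 or the flip; the two cases are the two cosets.
  obtain ⟨w, hw, e⟩ :=
    (isWeylChamber_dominantChamber.image baseVector_pos hb).exists_eq_image
  have hw' := reflectionGroup_le_autPlus hw
  have key : (w⁻¹ * b : Space ≃ₗ[ℝ] Space) '' dominantChamber = dominantChamber := by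
    ext x
    rw [mem_image_iff, mul_inv_rev, inv_inv, LinearEquiv.mul_apply, ← mem_image_iff, e,
      mem_image_iff, inv_apply_self]
  rcases eq_one_or_eq_flip (mul_mem (inv_mem hw') hb) key with h | h
  · obtain rfl : w = b := inv_mul_eq_one.1 h
    refine Or.inr ⟨hw, fun hwf => flip_notMem_reflectionGroup ?_⟩
    simpa using mul_mem (inv_mem hw) hwf
  · obtain rfl : b = w * flip := by rw [← h]; group
    refine Or.inl ⟨by rwa [mul_assoc, flip_mul_flip, mul_one], fun hwf =>
      flip_notMem_reflectionGroup ?_⟩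
    simpa using mul_mem (inv_mem hw) hwf

/-! ### Number of simple roots and the Dynkin diagram -/

theorem alpha_injective : Function.Injective alpha := by
  intro i j h
  have e : ∀ k, gram i k = gram j k := fun k => by
    have := form_alpha_alpha i k
    rw [h, form_alpha_alpha] at this
    exact_mod_cast this.symm
  revert e
  clear h
  revert i j
  decide

theorem IsWeylChamber.ncard_setOf_isSimpleRoot {D : Set Space}
    (hD : IsWeylChamber form lattice baseVector D) :
    {a | IsSimpleRoot form lattice baseVector D a}.ncard = 7 := by
  obtain ⟨w, hw, rfl⟩ := hD.exists_eq_image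
  rw [setOf_isSimpleRoot_image baseVector_pos (reflectionGroup_le_autPlus hw),
    Set.ncard_image_of_injective _ w.injective, setOf_isSimpleRoot_dominantChamber,
    ← Set.image_univ, Set.ncard_image_of_injective _ alpha_injective, Set.ncard_univ]
  simp

theorem chain_eq (i : Fin 7) : chain i = alpha (![1, 0, 6, 4, 5, 2, 3] i) := by
  fin_cases i <;> rfl

theorem gram_chain : ∀ i j : Fin 7, i < j →
    if i.val + 1 = j.val then
      if i = 0 ∨ j = 6 then
        gram (![1, 0, 6, 4, 5, 2, 3] i) (![1, 0, 6, 4, 5, 2, 3] j) = 3 ∧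
          gram (![1, 0, 6, 4, 5, 2, 3] i) (![1, 0, 6, 4, 5, 2, 3] i) *
            gram (![1, 0, 6, 4, 5, 2, 3] j) (![1, 0, 6, 4, 5, 2, 3] j) = 12
      else
        gram (![1, 0, 6, 4, 5, 2, 3] i) (![1, 0, 6, 4, 5, 2, 3] j) = 1 ∧
          gram (![1, 0, 6, 4, 5, 2, 3] i) (![1, 0, 6, 4, 5, 2, 3] i) *
            gram (![1, 0, 6, 4, 5, 2, 3] j) (![1, 0, 6, 4, 5, 2, 3] j) = 4
    else gram (![1, 0, 6, 4, 5, 2, 3] i) (![1, 0, 6, 4, 5, 2, 3] j) = 0 := by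
  decide

end LorentzianLattice

open LorentzianLattice
theorem mainTheorem8 :
    -- the simple roots of a suitable Weyl chamber, and its Weyl vector
    (∃ D : Set Space, IsWeylChamber form lattice baseVector D ∧
      {a | IsSimpleRoot form lattice baseVector D a} = Set.range alpha ∧
      {a | IsSimpleRoot form lattice baseVector D a} =
        {a | IsRoot form lattice a ∧ form rho a = form a a / 2} ∧
      (∀ v : Space, IsWeylVector form lattice baseVector D v ↔ v = rho)) ∧
    form rho rho = 56 ∧
    -- every Weyl chamber has 7 simple roots
    (∀ D : Set Space, IsWeylChamber form lattice baseVector D →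
      {a | IsSimpleRoot form lattice baseVector D a}.ncard = 7) ∧
    -- the norms of the simple roots
    (∀ i : Fin 7, form (alpha i) (alpha i) = if i = 1 ∨ i = 3 then -6 else -2) ∧
    -- the Dynkin diagram: a chain of 7 nodes with bonds 3, 1, 1, 1, 1, 3
    (∀ i j : Fin 7, i < j →
      0 ≤ form (chain i) (chain j) ∧
      bonds form (chain i) (chain j) =
        if i.val + 1 = j.val then (if i = 0 ∨ j = 6 then 3 else 1) else 0) ∧
    -- the reflection group is arithmetic, of index 2 in the group of automorphisms fixing the cones
    IsArithmetic form lattice baseVector ∧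
    reflectionGroup form lattice ≤ autPlus form lattice ∧
    (reflectionGroup form lattice).relIndex (autPlus form lattice) = 2 := by
  refine ⟨⟨dominantChamber, isWeylChamber_dominantChamber, setOf_isSimpleRoot_dominantChamber,
    setOf_isSimpleRoot_dominantChamber.trans setOf_form_rho_eq_range_alpha.symm,
    isWeylVector_iff⟩, form_rho, fun D hD => hD.ncard_setOf_isSimpleRoot, form_alpha_self,
    fun i j hij => ?_, isArithmetic_lattice, reflectionGroup_le_autPlus, relIndex_reflectionGroup⟩
  have h := gram_chain i j hij
  simp only [bonds, chain_eq, form_alpha_alpha]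
  generalize gram _ _ = m at h ⊢
  rw [← Int.cast_mul]
  generalize gram _ _ * gram _ _ = n at h ⊢
  split_ifs at h ⊢
  · obtain ⟨rfl, rfl⟩ := h
    norm_num
  · obtain ⟨rfl, rfl⟩ := h
    norm_num
  · subst h
    norm_num
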